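/- Let $F,G\in\mathbf C^{p\times n}$ and let $\Phi,\Psi$ be Hermitian $2\times2$ matrices with $\det\Phi<0$. Put $q_M(\mu,\nu)=\begin{bmatrix}\mu\\ \nu\end{bmatrix}^H M\begin{bmatrix}\mu\\ \nu\end{bmatrix}$ and $$\mathcal C=\{(\mu,\nu)\in\mathbf C^2 \mid (\mu,\nu)\ne0,\ q_\Phi(\mu,\nu)=0,\ q_\Psi(\mu,\nu)\le0\}.$$ Assume that $\mathcal C$, read in homogeneous coordinates, is neither empty nor a single point, i.e., it contains two nonproportional pairs. If $q_\Psi\le 0$ holds at every nonzero solution of $q_\Phi=0$ (the line or circle case), let $\mathcal C^\circ=\mathcal C$; otherwise (the segment case) let $\mathcal C^\circ=\{(\mu,\nu)\in\mathcal C\mid q_\Psi(\mu,\nu)<0\}$. Call a Hermitian $X\in\mathbf C^{n\times n}$ strictly feasible if $X\succ0$, $$\Phi_{11}FXF^H+\Phi_{21}FXG^H+\Phi_{12}GXF^H+\Phi_{22}GXG^H=0,$$ and, in the segment case, also $$\Psi_{11}FXF^H+\Psi_{21}FXG^H+\Psi_{12}GXF^H+\Psi_{22}GXG^H\prec0.$$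 In the line or circle case, assume in addition that the $p\times 2n$ matrix $[\,F\ \ G\,]$ has rank $p$ (that is, the rows of the pencil $\lambda G-F$ are linearly independent over $\mathbf C$). A Kronecker canonical form of $\lambda G-F$ is given by nonsingular $P,Q$ such that $P(\lambda G-F)Q$ is block diagonal with blocks $L_{\eta_1}(\lambda)^T,\dots,L_{\eta_l}(\lambda)^T$, $\lambda B-A$, $L_{\epsilon_1}(\lambda),\dots,L_{\epsilon_r}(\lambda)$, where $L_k(\lambda)=\lambda\,[\,I_k\ \ 0\,]-[\,0\ \ I_k\,]$ is $k\times(k+1)$, $k\ge0$, and $\lambda B-A$ is a regular pencil (square of some size $m\ge 0$, with $\det(\lambda B-A)\not\equiv0$). The generalized eigenvalues of $\lambda G-F$, with their multiplicities, are those of $\lambda B-A$: a finite one is a root $\lambda$ of $\det(\lambda B-A)$, with algebraic multiplicity its multiplicity as a root and geometric multiplicity $\dim\ker(\lambda B-A)$; infinity is one if $\det B=0$, with algebraic multiplicity $m-\deg\det(\lambda B-A)$ and geometric multiplicity $\dim\ker B$. The normal rank of $\lambda G-F$ is $\max_{\lambda\in\mathbf C}\operatorname{rank}(\lambda G-F)$.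 Then there exists a strictly feasible $X$ if and only if the following two conditions hold. 1. The normal rank of $\lambda G-F$ is $p$. 2. All generalized eigenvalues of $\lambda G-F$ are nondefective (algebraic multiplicity equals geometric multiplicity) and lie in $\mathcal C^\circ$, i.e., $(\lambda,1)\in\mathcal C^\circ$ for each finite generalized eigenvalue $\lambda$, and $(1,0)\in\mathcal C^\circ$ if infinity is a generalized eigenvalue. The equivalence holds both with condition 2 read as "some Kronecker canonical form of $\lambda G-F$ exists with these properties" and with condition 2 read for any given Kronecker canonical form. For any Kronecker canonical form, condition 1 means that $l=0$. If $\operatorname{rank}(\mu G-\nu F)=p$ for all $(\mu,\nu)\ne(0,0)$, then a strictly feasible $X$ exists; for any Kronecker canonical form, this rank condition means that $l=0$ and that the block $\lambda B-A$ is not present ($m=0$). -/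

import Mathlib

namespace PencilFeasibility

open Matrix
open scoped ComplexOrder

/-- The quadratic form `q_M(μ, ν) = [μ; ν]ᴴ M [μ; ν]` of a Hermitian `2 × 2` matrix `M`
(its value is real because `M` is Hermitian). -/
noncomputable def quadForm (M : Matrix (Fin 2) (Fin 2) ℂ) (μ ν : ℂ) : ℝ :=
  (star ![μ, ν] ⬝ᵥ (M *ᵥ ![μ, ν])).re

/-- The set `𝒞` of nonzero pairs with `q_Φ(μ, ν) = 0` and `q_Ψ(μ, ν) ≤ 0`. -/
def curve (Φ Ψ : Matrix (Fin 2) (Fin 2) ℂ) : Set (ℂ × ℂ) :=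
  {x | x ≠ 0 ∧ quadForm Φ x.1 x.2 = 0 ∧ quadForm Ψ x.1 x.2 ≤ 0}

/-- The inequality `q_Ψ ≤ 0` is redundant in the definition of `𝒞` (the case of a line or circle;
its negation is the case of a segment of a line or circle). -/
def IsRedundant (Φ Ψ : Matrix (Fin 2) (Fin 2) ℂ) : Prop :=
  ∀ μ ν : ℂ, (μ, ν) ≠ 0 → quadForm Φ μ ν = 0 → quadForm Ψ μ ν ≤ 0

/-- The set `𝒞°`: equal to `𝒞` in the line or circle case, and to the points of `𝒞` with
`q_Ψ(μ, ν) < 0` in the segment case. -/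
def curveInterior (Φ Ψ : Matrix (Fin 2) (Fin 2) ℂ) : Set (ℂ × ℂ) :=
  {x | x ∈ curve Φ Ψ ∧ (¬ IsRedundant Φ Ψ → quadForm Ψ x.1 x.2 < 0)}

/-- The points of `𝒞` are given in homogeneous coordinates; `𝒞` is neither empty nor a singleton
when it contains two nonproportional pairs. -/
def HasTwoPoints (C : Set (ℂ × ℂ)) : Prop :=
  ∃ x ∈ C, ∃ y ∈ C, x.1 * y.2 ≠ y.1 * x.2

variable {p n : ℕ}

/-- `M₁₁ F X Fᴴ + M₂₁ F X Gᴴ + M₁₂ G X Fᴴ + M₂₂ G X Gᴴ`. -/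
def lmi (M : Matrix (Fin 2) (Fin 2) ℂ) (F G : Matrix (Fin p) (Fin n) ℂ)
    (X : Matrix (Fin n) (Fin n) ℂ) : Matrix (Fin p) (Fin p) ℂ :=
  M 0 0 • (F * X * Fᴴ) + M 1 0 • (F * X * Gᴴ) + M 0 1 • (G * X * Fᴴ) + M 1 1 • (G * X * Gᴴ)

/-- Strict feasibility of `X`: `X ≻ 0`, the equality constraint, and, in the segment case,
the strict matrix inequality `lmi Ψ F G X ≺ 0`. -/
def StrictlyFeasible (Φ Ψ : Matrix (Fin 2) (Fin 2) ℂ) (F G : Matrix (Fin p) (Fin n) ℂ)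
    (X : Matrix (Fin n) (Fin n) ℂ) : Prop :=
  X.PosDef ∧ lmi Φ F G X = 0 ∧ (¬ IsRedundant Φ Ψ → (-lmi Ψ F G X).PosDef)

/-- The normal rank of the pencil `λ G - F`: the largest rank it attains (at most `p`). -/
noncomputable def normalRank (F G : Matrix (Fin p) (Fin n) ℂ) : ℕ :=
  ⨆ z : ℂ, (z • G - F).rank

/-- The `k × (k + 1)` pencil `L_k(z)`, with `z` on the diagonal and `-1` next to it. -/
def blockL (k : ℕ) (z : ℂ) : Matrix (Fin k) (Fin (k + 1)) ℂ :=
  Matrix.of fun i j => if j = i.castSucc then z else if j = i.succ then -1 else 0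

/-- The characteristic polynomial `det (λ B - A)` of a square pencil. -/
noncomputable def pencilDet {m : ℕ} (A B : Matrix (Fin m) (Fin m) ℂ) : Polynomial ℂ :=
  ((Polynomial.X : Polynomial ℂ) • B.map Polynomial.C - A.map Polynomial.C).det

/-- A Kronecker canonical form of the pencil `λ G - F`: nonsingular `P`, `Q` such that
`P (λ G - F) Q` is block diagonal with blocks `L_{η i}(λ)ᵀ` (`i < l`), a regular pencil `λ B - A`
of size `m`, and `L_{ε j}(λ)` (`j < r`). The indices `η i`, `ε j` may be zero. The bijections
`rowEquiv`, `colEquiv` number the rows and the columns of the block matrix. -/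
structure KroneckerForm (F G : Matrix (Fin p) (Fin n) ℂ) where
  l : ℕ
  η : Fin l → ℕ
  m : ℕ
  A : Matrix (Fin m) (Fin m) ℂ
  B : Matrix (Fin m) (Fin m) ℂ
  r : ℕ
  ε : Fin r → ℕ
  P : Matrix (Fin p) (Fin p) ℂ
  Q : Matrix (Fin n) (Fin n) ℂ
  rowEquiv : ((Σ i : Fin l, Fin (η i + 1)) ⊕ (Fin m ⊕ (Σ j : Fin r, Fin (ε j)))) ≃ Fin p
  colEquiv : ((Σ i : Fin l, Fin (η i)) ⊕ (Fin m ⊕ (Σ j : Fin r, Fin (ε j + 1)))) ≃ Fin n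
  isUnit_P : IsUnit P.det
  isUnit_Q : IsUnit Q.det
  regular : pencilDet A B ≠ 0
  eq_blocks : ∀ z : ℂ, P * (z • G - F) * Q = Matrix.reindex rowEquiv colEquiv
    (Matrix.fromBlocks (Matrix.blockDiagonal' fun i => (blockL (η i) z)ᵀ) 0 0
      (Matrix.fromBlocks (z • B - A) 0 0 (Matrix.blockDiagonal' fun j => blockL (ε j) z)))

/-- `z` is a finite generalized eigenvalue of the regular pencil `λ B - A`. -/
def IsFiniteEigenvalue {m : ℕ} (A B : Matrix (Fin m) (Fin m) ℂ) (z : ℂ) : Prop :=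
  (z • B - A).det = 0

/-- The regular pencil `λ B - A` has a generalized eigenvalue at infinity. -/
def IsInfiniteEigenvalue {m : ℕ} (B : Matrix (Fin m) (Fin m) ℂ) : Prop :=
  B.det = 0

/-- For every generalized eigenvalue of the regular pencil `λ B - A`, finite or infinite, the
algebraic multiplicity equals the geometric multiplicity. For a finite eigenvalue `z` these are
the multiplicity of `z` as a root of `det (λ B - A)` and `dim ker (z B - A) = m - rank (z B - A)`;
for the infinite one they are `m - deg det (λ B - A)` and `dim ker B = m - rank B`. -/
def Nondefective {m : ℕ} (A B : Matrix (Fin m) (Fin m) ℂ) : Prop :=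
  (∀ z : ℂ, IsFiniteEigenvalue A B z →
    (pencilDet A B).rootMultiplicity z = m - (z • B - A).rank) ∧
  (IsInfiniteEigenvalue B → m - (pencilDet A B).natDegree = m - B.rank)

/-- All generalized eigenvalues of the regular pencil `λ B - A` lie in `S`, where a finite
eigenvalue `z` is identified with `(z, 1)` and the infinite one with `(1, 0)`. -/
def EigenvaluesIn {m : ℕ} (A B : Matrix (Fin m) (Fin m) ℂ) (S : Set (ℂ × ℂ)) : Prop :=
  (∀ z : ℂ, IsFiniteEigenvalue A B z → (z, 1) ∈ S) ∧
  (IsInfiniteEigenvalue B → ((1, 0) : ℂ × ℂ) ∈ S)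

end PencilFeasibility

/-! Necessity. If a row vector `y` satisfies `yF = μu` and `yG = νu`, then `y (lmi M) y* = q_M(μ, ν)
· u X u*`, and `u X u* > 0` for `u ≠ 0`. So the constraints on `X` force `q_Φ(μ, ν) = 0` and, in the
segment case, `q_Ψ(μ, ν) < 0` at every left eigenvector. At a point off the curve `q_Φ = 0`, the
same identity kills every left null vector, which gives normal rank `p`. A left Jordan chain of
length two would yield two independent pairs, one `Φ`-isotropic and `Φ`-orthogonal to the other,
contradicting `det Φ ≠ 0`. The eigenvalue arguments are run on the regular block, to which
feasibility passes by compression (`strictlyFeasible_regular`).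

Sufficiency. If vectors `v` with `Fv = μw`, `Gv = νw` and `(μ, ν) ∈ 𝒞°` span the space, put finitely
many of them as columns of `V`, with the `w` as columns of `W`. Then `X = VVᴴ` gives `lmi M = W
diag(q_M) Wᴴ`, and feasibility can be read off. The regular block supplies such vectors from its
eigenvectors, which span because nothing is defective. A block `L_k` admits the vector of monomials
`ν^(k-a) μ^a` for every `(μ, ν)`; since `𝒞°` contains an arc (`exists_arc`), a projective
Vandermonde determinant shows that these span too.

Passing between the two readings of condition 2 needs a Kronecker form whenever the normal rank is
`p`. It is built by splitting off polynomial kernel vectors of minimal degree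
(`exists_kroneckerBasis`). -/

namespace PencilFeasibility

open Matrix
open scoped ComplexOrder

/-! ### Hermitian forms on pairs, an arc in `𝒞°`, and rank criteria -/

/-- The sesquilinear form of a `2 × 2` matrix, linear in the first argument. -/
def sesq (M : Matrix (Fin 2) (Fin 2) ℂ) (x y : ℂ × ℂ) : ℂ :=
  M 0 0 * (x.1 * star y.1) + M 1 0 * (x.1 * star y.2) + M 0 1 * (x.2 * star y.1) +
    M 1 1 * (x.2 * star y.2)

theorem sesq_swap {M : Matrix (Fin 2) (Fin 2) ℂ} (hM : M.IsHermitian) (x y : ℂ × ℂ) :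
    sesq M y x = star (sesq M x y) := by
  have h00 := hM.apply 0 0
  have h01 := hM.apply 0 1
  have h10 := hM.apply 1 0
  have h11 := hM.apply 1 1
  simp only [sesq, star_add, star_mul', star_star, h00, h01, h10, h11]
  ring

theorem quadForm_coe {M : Matrix (Fin 2) (Fin 2) ℂ} (hM : M.IsHermitian) (μ ν : ℂ) :
    (quadForm M μ ν : ℂ) = sesq M (μ, ν) (μ, ν) := by
  have h : star ![μ, ν] ⬝ᵥ (M *ᵥ ![μ, ν]) = sesq M (μ, ν) (μ, ν) := by
    simp [sesq, dotProduct, mulVec, Fin.sum_univ_two]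
    ring
  have h2 : (starRingEnd ℂ) (sesq M (μ, ν) (μ, ν)) = sesq M (μ, ν) (μ, ν) :=
    (sesq_swap hM _ _).symm
  rw [quadForm, h]
  exact Complex.conj_eq_iff_re.mp h2

theorem quadForm_mul {M : Matrix (Fin 2) (Fin 2) ℂ} (hM : M.IsHermitian) (c μ ν : ℂ) :
    quadForm M (c * μ) (c * ν) = Complex.normSq c * quadForm M μ ν := by
  apply Complex.ofReal_injective
  rw [Complex.ofReal_mul, quadForm_coe hM, quadForm_coe hM, ← Complex.mul_conj]
  simp only [sesq, star_mul', Complex.star_def]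
  ring

theorem quadForm_comb {M : Matrix (Fin 2) (Fin 2) ℂ} (hM : M.IsHermitian) (s t : ℂ)
    (x y : ℂ × ℂ) :
    quadForm M (s * x.1 + t * y.1) (s * x.2 + t * y.2) =
      Complex.normSq s * quadForm M x.1 x.2 + Complex.normSq t * quadForm M y.1 y.2 +
        2 * (s * star t * sesq M x y).re := by
  have h2 : ((2 * (s * star t * sesq M x y).re : ℝ) : ℂ) =
      s * star t * sesq M x y + t * star s * sesq M y x := by
    rw [sesq_swap hM x y, show t * star s * star (sesq M x y) =
      (starRingEnd ℂ) (s * star t * sesq M x y) by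
        simp only [map_mul, Complex.star_def, Complex.conj_conj]; ring, Complex.add_conj]
  apply Complex.ofReal_injective
  rw [Complex.ofReal_add, Complex.ofReal_add, h2, Complex.ofReal_mul, Complex.ofReal_mul,
    quadForm_coe hM, quadForm_coe hM, quadForm_coe hM, ← Complex.mul_conj, ← Complex.mul_conj]
  simp only [sesq, star_mul', star_add, Complex.star_def]
  ring

theorem sesq_mul_right (M : Matrix (Fin 2) (Fin 2) ℂ) (x y : ℂ × ℂ) (c : ℂ) :
    sesq M x (c * y.1, c * y.2) = star c * sesq M x y := by
  simp only [sesq, star_mul']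
  ring

/-- The Gram matrix of two vectors is congruent to `M` (up to transposition), so its determinant is
`det M` times the squared modulus of their determinant. -/
theorem sesq_gram (M : Matrix (Fin 2) (Fin 2) ℂ) (x y : ℂ × ℂ) :
    sesq M x x * sesq M y y - sesq M x y * sesq M y x =
      M.det * ((x.1 * y.2 - y.1 * x.2) * star (x.1 * y.2 - y.1 * x.2)) := by
  simp only [sesq, det_fin_two, star_sub, star_mul']
  ring

theorem mem_curveInterior_mul {Φ Ψ : Matrix (Fin 2) (Fin 2) ℂ} (hΦ : Φ.IsHermitian)
    (hΨ : Ψ.IsHermitian) {c μ ν : ℂ} (hc : c ≠ 0) (h : (μ, ν) ∈ curveInterior Φ Ψ) :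
    (c * μ, c * ν) ∈ curveInterior Φ Ψ := by
  have hp : 0 < Complex.normSq c := Complex.normSq_pos.mpr hc
  obtain ⟨⟨h0, h1, h2⟩, h3⟩ := h
  refine ⟨⟨?_, ?_, ?_⟩, fun hr => ?_⟩
  · intro h
    apply h0
    simpa [Prod.ext_iff, hc] using h
  · simp only [quadForm_mul hΦ] at h1 ⊢
    rw [h1, mul_zero]
  · simp only [quadForm_mul hΨ] at h2 ⊢
    exact mul_nonpos_of_nonneg_of_nonpos hp.le h2
  · have := h3 hr
    simp only [quadForm_mul hΨ] at this ⊢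
    exact mul_neg_of_pos_of_neg hp this

/-- The set `𝒞°` contains an arc of pairwise nonproportional points. -/
theorem exists_arc {Φ Ψ : Matrix (Fin 2) (Fin 2) ℂ} (hΦ : Φ.IsHermitian) (hΨ : Ψ.IsHermitian)
    (hdet : Φ.det.re < 0) (hC : HasTwoPoints (curve Φ Ψ)) :
    ∃ x y : ℂ × ℂ, x.1 * y.2 - y.1 * x.2 ≠ 0 ∧
      ∀ t : ℝ, 0 < t → (x.1 + t * y.1, x.2 + t * y.2) ∈ curveInterior Φ Ψ := by
  obtain ⟨x, ⟨-, hx1, hx2⟩, y, ⟨-, hy1, hy2⟩, hxy⟩ := hC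
  have hxy' : x.1 * y.2 - y.1 * x.2 ≠ 0 := sub_ne_zero.mpr hxy
  set c := sesq Φ x y with hc
  have hc0 : c ≠ 0 := by
    intro h0
    have h := sesq_gram Φ x y
    rw [← hc, h0, ← quadForm_coe hΦ x.1 x.2, hx1] at h
    simp only [Complex.ofReal_zero, zero_mul, sub_self, zero_eq_mul] at h
    rcases h with h | h
    · simp [h] at hdet
    · exact mul_ne_zero hxy' (star_ne_zero.mpr hxy') h
  -- Rescaling `y` by `κ` makes `sesq Φ x y'` purely imaginary, so that every real combination `x +
  -- t y'` stays isotropic for `Φ`. The sign `σ` makes the cross term of `q_Ψ` nonpositive for `t >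
  -- 0`.
  obtain ⟨σ, hσ, hσΨ⟩ : ∃ σ : ℝ, σ ≠ 0 ∧
      (σ * (Complex.I * star c * sesq Ψ x y)).re ≤ 0 := by
    rcases le_total (Complex.I * star c * sesq Ψ x y).re 0 with h | h
    · exact ⟨1, one_ne_zero, by simpa using h⟩
    · exact ⟨-1, by norm_num, by simpa using h⟩
  set κ : ℂ := star (σ * (Complex.I * star c)) with hκ
  have hκ0 : κ ≠ 0 := by simp [hκ, hσ, hc0]
  have hsΨ : sesq Ψ x (κ * y.1, κ * y.2) = σ * (Complex.I * star c * sesq Ψ x y) := by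
    rw [sesq_mul_right, hκ, star_star]; ring
  have hsΦ : sesq Φ x (κ * y.1, κ * y.2) = (σ * Complex.normSq c : ℝ) * Complex.I := by
    rw [Complex.ofReal_mul, ← Complex.mul_conj, sesq_mul_right, hκ, star_star, ← hc,
      Complex.star_def]
    ring
  set y' : ℂ × ℂ := (κ * y.1, κ * y.2) with hy'
  have hy'1 : quadForm Φ y'.1 y'.2 = 0 := by simp [hy', quadForm_mul hΦ, hy1]
  have hy'2 : quadForm Ψ y'.1 y'.2 ≤ 0 := by
    simp only [hy', quadForm_mul hΨ]
    exact mul_nonpos_of_nonneg_of_nonpos (Complex.normSq_nonneg _) hy2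
  have hxy2 : x.1 * y'.2 - y'.1 * x.2 ≠ 0 := by
    have : x.1 * y'.2 - y'.1 * x.2 = κ * (x.1 * y.2 - y.1 * x.2) := by simp [hy']; ring
    rw [this]; exact mul_ne_zero hκ0 hxy'
  have hr0 : σ * Complex.normSq c ≠ 0 := mul_ne_zero hσ (by simpa using hc0)
  clear_value y'
  rw [← hsΨ] at hσΨ
  generalize σ * Complex.normSq c = r at hsΦ hr0
  refine ⟨x, y', hxy2, fun t ht => ?_⟩
  have hΦt : quadForm Φ (x.1 + t * y'.1) (x.2 + t * y'.2) = 0 := by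
    have := quadForm_comb hΦ 1 t x y'
    simp only [one_mul] at this
    rw [this, hx1, hy'1, hsΦ]
    simp
  have hΨt : quadForm Ψ (x.1 + t * y'.1) (x.2 + t * y'.2) =
      quadForm Ψ x.1 x.2 + t ^ 2 * quadForm Ψ y'.1 y'.2 + 2 * (t * (sesq Ψ x y').re) := by
    have := quadForm_comb hΨ 1 t x y'
    simp only [one_mul] at this
    rw [this]
    simp [Complex.normSq_ofReal, sq]
  have ha := mul_nonneg (sq_nonneg t) (neg_nonneg.mpr hy'2)
  have hb := mul_nonneg ht.le (neg_nonneg.mpr hσΨ)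
  refine ⟨⟨?_, hΦt, ?_⟩, fun hred => ?_⟩
  · intro h
    simp only [Prod.ext_iff, Prod.fst_zero, Prod.snd_zero] at h
    apply hxy2
    linear_combination y'.2 * h.1 - y'.1 * h.2
  · simp only; rw [hΨt]; nlinarith
  -- A zero value of `q_Ψ` at some `t > 0` makes all three nonpositive terms vanish. On `q_Φ = 0`
  -- the product `s * star u` is real, so `q_Ψ` is zero there, which contradicts the segment case.
  · by_contra hneg
    simp only [not_lt] at hneg
    rw [hΨt] at hneg
    apply hred
    have h1 : quadForm Ψ x.1 x.2 = 0 := by nlinarith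
    have h2 : quadForm Ψ y'.1 y'.2 = 0 := by
      have : t ^ 2 * quadForm Ψ y'.1 y'.2 = 0 := by nlinarith
      simpa [ht.ne'] using this
    have h3 : (sesq Ψ x y').re = 0 := by
      have : t * (sesq Ψ x y').re = 0 := by nlinarith
      simpa [ht.ne'] using this
    intro μ ν _ hq
    set d := x.1 * y'.2 - y'.1 * x.2
    obtain ⟨s, u, hs, hu⟩ : ∃ s u : ℂ, μ = s * x.1 + u * y'.1 ∧ ν = s * x.2 + u * y'.2 := by
      refine ⟨(μ * y'.2 - ν * y'.1) / d, (ν * x.1 - μ * x.2) / d, ?_, ?_⟩ <;>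
      · field_simp
        simp only [d]; ring
    rw [hs, hu, quadForm_comb hΦ, hx1, hy'1, hsΦ] at hq
    have him : (s * star u).im = 0 := by
      simp only [mul_zero, zero_add] at hq
      rw [← mul_assoc, Complex.mul_I_re, Complex.im_mul_ofReal] at hq
      simpa [hr0] using hq
    rw [hs, hu, quadForm_comb hΨ, h1, h2, Complex.mul_re (s * star u), him, h3]
    simp

variable {ι κ : Type*} [Fintype ι] [Fintype κ]

theorem rank_eq_card_iff (A : Matrix ι κ ℂ) :
    A.rank = Fintype.card ι ↔ ∀ y : ι → ℂ, y ᵥ* A = 0 → y = 0 := by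
  rw [← rank_transpose, rank]
  have h := Aᵀ.mulVecLin.finrank_range_add_finrank_ker
  rw [Module.finrank_fintype_fun_eq_card] at h
  have h2 : (∀ y : ι → ℂ, y ᵥ* A = 0 → y = 0) ↔ LinearMap.ker Aᵀ.mulVecLin = ⊥ := by
    rw [LinearMap.ker_eq_bot']
    simp
  rw [h2, ← Submodule.finrank_eq_zero]
  omega

theorem rank_eq_iff {p n : ℕ} (A : Matrix (Fin p) (Fin n) ℂ) :
    A.rank = p ↔ ∀ y : Fin p → ℂ, y ᵥ* A = 0 → y = 0 := by
  simpa using rank_eq_card_iff A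

theorem normalRank_eq_iff {p n : ℕ} (F G : Matrix (Fin p) (Fin n) ℂ) :
    normalRank F G = p ↔ ∃ z : ℂ, (z • G - F).rank = p := by
  have hb : BddAbove (Set.range fun z : ℂ => (z • G - F).rank) :=
    ⟨p, by rintro _ ⟨z, rfl⟩; exact rank_le_height _⟩
  constructor
  · intro h
    have := Nat.sSup_mem (Set.range_nonempty fun z : ℂ => (z • G - F).rank) hb
    obtain ⟨z, hz⟩ := this
    exact ⟨z, hz.trans h⟩
  · rintro ⟨z, hz⟩
    apply le_antisymm
    · exact ciSup_le fun z => rank_le_height _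
    · exact hz.ge.trans (le_ciSup hb z)

theorem vecMul_lmi_dotProduct {p n : ℕ} (M : Matrix (Fin 2) (Fin 2) ℂ)
    (F G : Matrix (Fin p) (Fin n) ℂ) (X : Matrix (Fin n) (Fin n) ℂ) (y y' : Fin p → ℂ) :
    y ᵥ* lmi M F G X ⬝ᵥ star y' =
      M 0 0 * ((y ᵥ* F) ᵥ* X ⬝ᵥ star (y' ᵥ* F)) + M 1 0 * ((y ᵥ* F) ᵥ* X ⬝ᵥ star (y' ᵥ* G)) +
      M 0 1 * ((y ᵥ* G) ᵥ* X ⬝ᵥ star (y' ᵥ* F)) +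
      M 1 1 * ((y ᵥ* G) ᵥ* X ⬝ᵥ star (y' ᵥ* G)) := by
  have key : ∀ H K : Matrix (Fin p) (Fin n) ℂ,
      y ᵥ* (H * X * Kᴴ) ⬝ᵥ star y' = (y ᵥ* H) ᵥ* X ⬝ᵥ star (y' ᵥ* K) := by
    intro H K
    rw [← vecMul_vecMul, ← vecMul_vecMul, star_vecMul, dotProduct_mulVec]
  simp only [lmi, vecMul_add, vecMul_smul, add_dotProduct, smul_dotProduct, key, smul_eq_mul]

theorem vecMul_lmi_of_proportional {p n : ℕ} {M : Matrix (Fin 2) (Fin 2) ℂ} (hM : M.IsHermitian)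
    {F G : Matrix (Fin p) (Fin n) ℂ} (X : Matrix (Fin n) (Fin n) ℂ) {y : Fin p → ℂ}
    {u : Fin n → ℂ} {μ ν : ℂ} (hF : y ᵥ* F = μ • u) (hG : y ᵥ* G = ν • u) :
    y ᵥ* lmi M F G X ⬝ᵥ star y = quadForm M μ ν * (u ᵥ* X ⬝ᵥ star u) := by
  rw [vecMul_lmi_dotProduct, hF, hG, quadForm_coe hM]
  simp only [sesq, smul_vecMul, star_smul, smul_dotProduct, dotProduct_smul, smul_eq_mul]
  ring

theorem posDef_vecMul_pos {n : ℕ} {X : Matrix (Fin n) (Fin n) ℂ} (hX : X.PosDef) {u : Fin n → ℂ}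
    (hu : u ≠ 0) : 0 < u ᵥ* X ⬝ᵥ star u := by
  have := hX.dotProduct_mulVec_pos (x := star u) (by simpa using hu)
  rwa [star_star, dotProduct_mulVec] at this

end PencilFeasibility

/-! ### Multiplicities of a regular pencil through a single matrix -/

namespace PencilFeasibility

open Matrix
open scoped ComplexOrder

theorem eval_pencilDet {m : ℕ} (A B : Matrix (Fin m) (Fin m) ℂ) (z : ℂ) :
    (pencilDet A B).eval z = (z • B - A).det := by
  rw [pencilDet, ← Polynomial.coe_evalRingHom, RingHom.map_det]
  congr 1
  ext i j
  simp
  ring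

theorem exists_det_ne_zero {m : ℕ} {A B : Matrix (Fin m) (Fin m) ℂ} (h : pencilDet A B ≠ 0) :
    ∃ z : ℂ, (z • B - A).det ≠ 0 := by
  by_contra hc
  push Not at hc
  apply h
  apply Polynomial.funext
  intro z
  rw [eval_pencilDet, hc, Polynomial.eval_zero]

/-- The factor `1 + (X - c) t` has at most one root, and it is `z` exactly when `t = -(z - c)⁻¹`. -/
theorem rootMultiplicity_prod (c z : ℂ) (hz : z ≠ c) (s : Multiset ℂ) :
    ((s.map fun t => (1 + (Polynomial.X - Polynomial.C c) * Polynomial.C t)).prod ≠ 0) ∧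
    (s.map fun t => (1 + (Polynomial.X - Polynomial.C c) * Polynomial.C t)).prod.rootMultiplicity z
      = s.count (-(z - c)⁻¹) := by
  induction s using Multiset.induction_on with
  | empty => simp [Polynomial.rootMultiplicity_eq_zero]
  | cons t s ih =>
    have hzc : z - c ≠ 0 := sub_ne_zero.mpr hz
    obtain ⟨h0, ih⟩ := ih
    have h1 : (1 + (Polynomial.X - Polynomial.C c) * Polynomial.C t : Polynomial ℂ) ≠ 0 := by
      intro h
      have := congrArg (Polynomial.eval c) h
      simp at this
    have h2 : (1 + (Polynomial.X - Polynomial.C c) * Polynomial.C t).rootMultiplicity z =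
        if -(z - c)⁻¹ = t then 1 else 0 := by
      split_ifs with h
      · have : (1 + (Polynomial.X - Polynomial.C c) * Polynomial.C t : Polynomial ℂ) =
            Polynomial.C t * (Polynomial.X - Polynomial.C z) := by
          have e : (1 : Polynomial ℂ) = Polynomial.C (t * (c - z)) := by
            rw [← h, show -(z - c)⁻¹ * (c - z) = 1 by field_simp; ring, Polynomial.C_1]
          rw [e]
          simp only [Polynomial.C_mul, Polynomial.C_sub]
          ring
        have ht : t ≠ 0 := by rw [← h]; simpa using hzc
        rw [this, Polynomial.rootMultiplicity_mul (mul_ne_zero (by simpa using ht)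
          (Polynomial.X_sub_C_ne_zero z)), Polynomial.rootMultiplicity_C,
          Polynomial.rootMultiplicity_X_sub_C_self]
      · apply Polynomial.rootMultiplicity_eq_zero
        intro hr
        apply h
        simp only [Polynomial.IsRoot, Polynomial.eval_add, Polynomial.eval_one,
          Polynomial.eval_mul, Polynomial.eval_sub, Polynomial.eval_X, Polynomial.eval_C] at hr
        field_simp
        linear_combination -hr
    rw [Multiset.map_cons, Multiset.prod_cons]
    refine ⟨mul_ne_zero h1 h0, ?_⟩
    rw [Polynomial.rootMultiplicity_mul (mul_ne_zero h1 h0), h2, ih, Multiset.count_cons]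
    omega

/-- A factor is constant exactly when `t = 0`; the drop in degree is what counts the eigenvalue at
infinity. -/
theorem natDegree_prod (c : ℂ) (s : Multiset ℂ) :
    ((s.map fun t => (1 + (Polynomial.X - Polynomial.C c) * Polynomial.C t)).prod).natDegree +
      s.count 0 = s.card := by
  induction s using Multiset.induction_on with
  | empty => simp
  | cons t s ih =>
    have h1 : (1 + (Polynomial.X - Polynomial.C c) * Polynomial.C t : Polynomial ℂ) ≠ 0 := by
      intro h
      have := congrArg (Polynomial.eval c) h
      simp at this
    have h0 := (rootMultiplicity_prod c (c + 1) (by simp) s).1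
    have h2 : (1 + (Polynomial.X - Polynomial.C c) * Polynomial.C t).natDegree =
        if 0 = t then 0 else 1 := by
      split_ifs with h
      · simp [← h]
      · have : (1 + (Polynomial.X - Polynomial.C c) * Polynomial.C t : Polynomial ℂ) =
            Polynomial.C t * Polynomial.X + Polynomial.C (1 - c * t) := by
          simp only [Polynomial.C_mul, Polynomial.C_sub, Polynomial.C_1]
          ring
        rw [this, Polynomial.natDegree_linear (Ne.symm h)]
    rw [Multiset.map_cons, Multiset.prod_cons, Polynomial.natDegree_mul h1 h0, h2,
      Multiset.count_cons, Multiset.card_cons]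
    split_ifs <;> omega

theorem det_one_add_smul {m : ℕ} (T : Matrix (Fin m) (Fin m) ℂ) (s : ℂ) :
    (1 + s • T).det = (T.charpoly.roots.map fun t => 1 + s * t).prod := by
  have hs : T.charpoly.Splits := IsAlgClosed.splits _
  have hcard : T.charpoly.roots.card = m := by
    rw [← hs.natDegree_eq_card_roots, T.charpoly_natDegree_eq_dim, Fintype.card_fin]
  rcases eq_or_ne s 0 with rfl | h
  · simp
  have h1 : (1 + s • T) = (-s) • (scalar (Fin m) (-s⁻¹) - T) := by
    rw [smul_sub, scalar_apply, ← smul_one_eq_diagonal, smul_smul]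
    simp [h]
  rw [h1, det_smul, ← T.eval_charpoly, hs.eval_eq_prod_roots_of_monic T.charpoly_monic,
    Fintype.card_fin]
  nth_rw 1 [← hcard]
  rw [← Multiset.prod_replicate, ← Multiset.map_const', ← Multiset.prod_map_mul]
  congr 1
  apply Multiset.map_congr rfl
  intro t _
  field_simp
  ring

/-- Reduces the pencil to `T = B (cB - A)⁻¹`: an eigenvalue `t ≠ 0` of `T` corresponds to `z = c -
t⁻¹`, and `t = 0` to infinity. -/
theorem pencil_factor {m : ℕ} {A B : Matrix (Fin m) (Fin m) ℂ} {c : ℂ}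
    (hc : (c • B - A).det ≠ 0) (z : ℂ) :
    z • B - A = (1 + (z - c) • (B * (c • B - A)⁻¹)) * (c • B - A) := by
  rw [add_mul, one_mul, smul_mul_assoc, mul_assoc, nonsing_inv_mul _ (isUnit_iff_ne_zero.mpr hc),
    mul_one, sub_smul]
  abel

theorem pencilDet_eq {m : ℕ} {A B : Matrix (Fin m) (Fin m) ℂ} {c : ℂ}
    (hc : (c • B - A).det ≠ 0) :
    pencilDet A B = Polynomial.C (c • B - A).det *
      ((B * (c • B - A)⁻¹).charpoly.roots.map
        fun t => (1 + (Polynomial.X - Polynomial.C c) * Polynomial.C t)).prod := by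
  apply Polynomial.funext
  intro z
  rw [eval_pencilDet, pencil_factor hc z, det_mul, det_one_add_smul, Polynomial.eval_mul,
    Polynomial.eval_C, mul_comm, Polynomial.eval_multiset_prod, Multiset.map_map]
  simp

/-- The eigenvalues of `C` have equal algebraic and geometric multiplicities. -/
def IsNondefective {m : ℕ} (C : Matrix (Fin m) (Fin m) ℂ) : Prop :=
  ∀ t : ℂ, C.charpoly.rootMultiplicity t = m - (C - t • 1).rank

theorem rootMultiplicity_pencilDet {m : ℕ} {A B : Matrix (Fin m) (Fin m) ℂ} {c : ℂ}
    (hc : (c • B - A).det ≠ 0) {z : ℂ} (hz : z ≠ c) :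
    (pencilDet A B).rootMultiplicity z =
      (B * (c • B - A)⁻¹).charpoly.rootMultiplicity (-(z - c)⁻¹) := by
  have h := rootMultiplicity_prod c z hz (B * (c • B - A)⁻¹).charpoly.roots
  rw [pencilDet_eq hc, Polynomial.rootMultiplicity_mul
    (mul_ne_zero (by simpa using hc) h.1), Polynomial.rootMultiplicity_C, zero_add, h.2,
    Polynomial.count_roots]

theorem natDegree_pencilDet {m : ℕ} {A B : Matrix (Fin m) (Fin m) ℂ} {c : ℂ}
    (hc : (c • B - A).det ≠ 0) :
    m - (pencilDet A B).natDegree = (B * (c • B - A)⁻¹).charpoly.rootMultiplicity 0 := by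
  set T := B * (c • B - A)⁻¹
  have hs : T.charpoly.Splits := IsAlgClosed.splits _
  have hcard : T.charpoly.roots.card = m := by
    rw [← hs.natDegree_eq_card_roots, T.charpoly_natDegree_eq_dim, Fintype.card_fin]
  have h := natDegree_prod c T.charpoly.roots
  rw [Polynomial.count_roots, hcard] at h
  rw [pencilDet_eq hc, Polynomial.natDegree_C_mul hc]
  exact (Nat.eq_sub_of_add_eq' h).symm

theorem rank_pencil {m : ℕ} {A B : Matrix (Fin m) (Fin m) ℂ} {c : ℂ}
    (hc : (c • B - A).det ≠ 0) {z : ℂ} (hz : z ≠ c) :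
    (z • B - A).rank = (B * (c • B - A)⁻¹ - (-(z - c)⁻¹) • 1).rank := by
  have hzc : z - c ≠ 0 := sub_ne_zero.mpr hz
  have : 1 + (z - c) • (B * (c • B - A)⁻¹) =
      (z - c) • (B * (c • B - A)⁻¹ - (-(z - c)⁻¹) • 1) := by
    rw [smul_sub, smul_smul]
    simp [hzc]
    abel
  rw [pencil_factor hc z, rank_mul_eq_left_of_isUnit_det _ _ (isUnit_iff_ne_zero.mpr hc), this,
    rank_smul_of_mem_nonZeroDivisors _ (mem_nonZeroDivisors_of_ne_zero hzc)]

theorem rank_leading {m : ℕ} {A B : Matrix (Fin m) (Fin m) ℂ} {c : ℂ}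
    (hc : (c • B - A).det ≠ 0) :
    B.rank = (B * (c • B - A)⁻¹ - (0 : ℂ) • 1).rank := by
  rw [zero_smul, sub_zero, rank_mul_eq_left_of_isUnit_det]
  exact (isUnit_nonsing_inv_det_iff).mpr (isUnit_iff_ne_zero.mpr hc)

theorem charpoly_isRoot_iff {m : ℕ} (C : Matrix (Fin m) (Fin m) ℂ) (t : ℂ) :
    C.charpoly.IsRoot t ↔ (C - t • 1).det = 0 := by
  rw [Polynomial.IsRoot, eval_charpoly, ← neg_sub C, det_neg, scalar_apply,
    ← smul_one_eq_diagonal]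
  simp

theorem nondefective_iff {m : ℕ} {A B : Matrix (Fin m) (Fin m) ℂ} {c : ℂ}
    (hc : (c • B - A).det ≠ 0) :
    Nondefective A B ↔ IsNondefective (B * (c • B - A)⁻¹) := by
  constructor
  · rintro ⟨hfin, hinf⟩ t
    set T := B * (c • B - A)⁻¹
    by_cases hroot : T.charpoly.IsRoot t
    swap
    -- Off the spectrum both multiplicities are zero.
    · rw [Polynomial.rootMultiplicity_eq_zero hroot]
      rw [charpoly_isRoot_iff] at hroot
      simp [rank_of_det_ne_zero hroot]
    rcases eq_or_ne t 0 with rfl | ht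
    · rw [← natDegree_pencilDet hc, ← rank_leading hc]
      apply hinf
      rw [charpoly_isRoot_iff] at hroot
      simp only [zero_smul, sub_zero, T, det_mul, det_nonsing_inv, Ring.inverse_eq_inv',
        mul_eq_zero, inv_eq_zero, hc, or_false] at hroot
      exact hroot
    · have hz : c - t⁻¹ ≠ c := by simpa using ht
      have ht' : t = -(c - t⁻¹ - c)⁻¹ := by simp
      have hr := rank_pencil hc hz
      have hd := rootMultiplicity_pencilDet hc hz
      rw [← ht'] at hr hd
      rw [← hr, ← hd]
      apply hfin
      rw [charpoly_isRoot_iff] at hroot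
      by_contra hne
      have h1 := rank_of_det_ne_zero hne
      rw [hr] at h1
      have h2 := (rank_eq_card_iff _).mp h1
      obtain ⟨v, hv, hv0⟩ := exists_vecMul_eq_zero_iff.mpr hroot
      exact hv (h2 v hv0)
  · intro h
    refine ⟨fun z hz => ?_, fun _ => ?_⟩
    · have hzc : z ≠ c := by rintro rfl; exact hc hz
      rw [rootMultiplicity_pencilDet hc hzc, rank_pencil hc hzc, h]
    · rw [natDegree_pencilDet hc, rank_leading hc, h]

theorem finrank_eigenspace {m : ℕ} (C : Matrix (Fin m) (Fin m) ℂ) (t : ℂ) :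
    Module.finrank ℂ (Module.End.eigenspace C.mulVecLin t) = m - (C - t • 1).rank := by
  have h := (C - t • (1 : Matrix (Fin m) (Fin m) ℂ)).mulVecLin.finrank_range_add_finrank_ker
  rw [Module.finrank_fintype_fun_eq_card, Fintype.card_fin] at h
  have h2 : (C - t • (1 : Matrix (Fin m) (Fin m) ℂ)).mulVecLin = C.mulVecLin - t • 1 := by
    ext; simp
  rw [h2] at h
  rw [rank, h2, Module.End.eigenspace_def]
  exact Nat.eq_sub_of_add_eq' h

theorem finrank_maxGenEigenspace {m : ℕ} (C : Matrix (Fin m) (Fin m) ℂ) (t : ℂ) :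
    Module.finrank ℂ (Module.End.maxGenEigenspace C.mulVecLin t) =
      C.charpoly.rootMultiplicity t := by
  rw [LinearMap.finrank_maxGenEigenspace_eq]
  congr 1
  rw [← charpoly_toLin']
  rfl

/-- Without Jordan chains of length two, `(C - t)ᵏ⁺¹ x = 0` descends inductively to `(C - t) x = 0`,
so generalized eigenspaces are eigenspaces. -/
theorem isNondefective_of_no_chain {m : ℕ} (C : Matrix (Fin m) (Fin m) ℂ)
    (h : ∀ (t : ℂ) (v w : Fin m → ℂ), C *ᵥ v = t • v → C *ᵥ w = t • w + v → v = 0) :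
    IsNondefective C := by
  intro t
  rw [← finrank_eigenspace, ← finrank_maxGenEigenspace]
  suffices Module.End.maxGenEigenspace C.mulVecLin t = Module.End.eigenspace C.mulVecLin t by
    rw [this]
  apply le_antisymm _ Module.End.eigenspace_le_maxGenEigenspace
  intro x hx
  rw [Module.End.mem_maxGenEigenspace] at hx
  obtain ⟨k, hk⟩ := hx
  induction k generalizing x with
  | zero => simp at hk; simp [hk]
  | succ k ih =>
    rw [pow_succ, Module.End.mul_apply] at hk
    have h1 := ih hk
    rw [Module.End.mem_eigenspace_iff] at h1 ⊢
    have := h t _ x h1 (by simp)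
    simpa [sub_eq_zero] using this

theorem span_eigenvectors {m : ℕ} {C : Matrix (Fin m) (Fin m) ℂ} (h : IsNondefective C) :
    Submodule.span ℂ {v : Fin m → ℂ | ∃ t : ℂ, C.charpoly.IsRoot t ∧ C *ᵥ v = t • v} = ⊤ := by
  rw [eq_top_iff, ← Module.End.iSup_maxGenEigenspace_eq_top C.mulVecLin]
  apply iSup_le
  intro t
  have h1 : Module.End.eigenspace C.mulVecLin t = Module.End.maxGenEigenspace C.mulVecLin t := by
    apply Submodule.eq_of_le_of_finrank_eq Module.End.eigenspace_le_maxGenEigenspace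
    rw [finrank_eigenspace, finrank_maxGenEigenspace, h]
  rw [← h1]
  intro v hv
  rcases eq_or_ne v 0 with rfl | hv0
  · exact zero_mem _
  have hv' : C *ᵥ v = t • v := by simpa using Module.End.mem_eigenspace_iff.mp hv
  refine Submodule.subset_span ⟨t, ?_, hv'⟩
  rw [charpoly_isRoot_iff]
  exact exists_mulVec_eq_zero_iff.mp ⟨v, hv0, by simp [sub_mulVec, smul_mulVec, hv']⟩

end PencilFeasibility

/-! ### Necessity of the conditions -/

namespace PencilFeasibility

open Matrix
open scoped ComplexOrder

variable {p n m : ℕ} {Φ Ψ : Matrix (Fin 2) (Fin 2) ℂ}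

/-- The values at `z = 0, 1, -1, i` determine all entries of `Φ`; were they all zero, `det Φ` would
vanish. -/
theorem exists_quadForm_ne_zero (hΦ : Φ.IsHermitian) (hdet : Φ.det.re < 0) :
    ∃ z : ℂ, quadForm Φ z 1 ≠ 0 := by
  by_contra! h
  have key : ∀ z : ℂ, sesq Φ (z, 1) (z, 1) = 0 := fun z => by rw [← quadForm_coe hΦ, h]; simp
  have h0 := key 0
  have h1 := key 1
  have h2 := key (-1)
  have h3 := key Complex.I
  simp only [sesq, Complex.star_def, map_zero, map_one, map_neg, Complex.conj_I] at h0 h1 h2 h3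
  have a : Φ 1 1 = 0 := by linear_combination h0
  have b : Φ 0 0 = 0 := by linear_combination (h1 + h2) / 2 - a
  have c : Φ 1 0 + Φ 0 1 = 0 := by linear_combination (h1 - h2) / 2
  have d : Φ 1 0 = Φ 0 1 := by
    have : Complex.I * (Φ 1 0 - Φ 0 1) = 0 := by
      rw [a, b] at h3
      linear_combination h3
    simpa [sub_eq_zero] using this
  have e : Φ 0 1 = 0 := by rw [d] at c; simpa using c
  rw [det_fin_two, a, d, e] at hdet
  simp at hdet

/-- In the segment case the definiteness of `lmi Ψ F G X` does the work of the rank assumption. -/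
theorem StrictlyFeasible.eq_zero_of_vecMul {F G : Matrix (Fin p) (Fin n) ℂ}
    {X : Matrix (Fin n) (Fin n) ℂ} (hX : StrictlyFeasible Φ Ψ F G X)
    (hrow : IsRedundant Φ Ψ → (fromCols F G).rank = p) {y : Fin p → ℂ}
    (hF : y ᵥ* F = 0) (hG : y ᵥ* G = 0) : y = 0 := by
  by_cases hr : IsRedundant Φ Ψ
  · refine (rank_eq_card_iff _).mp ((hrow hr).trans (Fintype.card_fin p).symm) y ?_
    rw [vecMul_fromCols, hF, hG]
    ext i
    cases i <;> rfl
  · by_contra hy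
    have h1 := posDef_vecMul_pos (hX.2.2 hr) hy
    rw [vecMul_neg, neg_dotProduct, vecMul_lmi_dotProduct, hF, hG] at h1
    simp at h1

theorem StrictlyFeasible.mem_curveInterior (hΦ : Φ.IsHermitian) (hΨ : Ψ.IsHermitian)
    {F G : Matrix (Fin p) (Fin n) ℂ} {X : Matrix (Fin n) (Fin n) ℂ}
    (hX : StrictlyFeasible Φ Ψ F G X) {y : Fin p → ℂ} {u : Fin n → ℂ} {μ ν : ℂ}
    (hF : y ᵥ* F = μ • u) (hG : y ᵥ* G = ν • u) (hy : y ≠ 0) (hu : u ≠ 0) (hμν : (μ, ν) ≠ 0) :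
    (μ, ν) ∈ curveInterior Φ Ψ := by
  have hpos := posDef_vecMul_pos hX.1 hu
  have h1 := vecMul_lmi_of_proportional hΦ X hF hG
  rw [hX.2.1, vecMul_zero, zero_dotProduct, zero_eq_mul, Complex.ofReal_eq_zero] at h1
  have hq : quadForm Φ μ ν = 0 := h1.resolve_right hpos.ne'
  have hneg : ¬ IsRedundant Φ Ψ → quadForm Ψ μ ν < 0 := by
    intro hr
    have h2 := posDef_vecMul_pos (hX.2.2 hr) hy
    rw [vecMul_neg, neg_dotProduct, vecMul_lmi_of_proportional hΨ X hF hG] at h2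
    rw [Complex.lt_def] at h2 hpos
    simp only [Complex.zero_re, Complex.neg_re, Complex.re_ofReal_mul] at h2 hpos
    nlinarith [h2.1, hpos.1]
  refine ⟨⟨hμν, hq, ?_⟩, hneg⟩
  by_cases hr : IsRedundant Φ Ψ
  · exact hr μ ν hμν hq
  · exact (hneg hr).le

theorem StrictlyFeasible.normalRank_eq (hΦ : Φ.IsHermitian) (hdet : Φ.det.re < 0)
    {F G : Matrix (Fin p) (Fin n) ℂ} {X : Matrix (Fin n) (Fin n) ℂ}
    (hX : StrictlyFeasible Φ Ψ F G X)
    (hrow : IsRedundant Φ Ψ → (fromCols F G).rank = p) : normalRank F G = p := by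
  obtain ⟨z, hz⟩ := exists_quadForm_ne_zero hΦ hdet
  rw [normalRank_eq_iff]
  refine ⟨z, (rank_eq_iff _).mpr fun y hy => ?_⟩
  have hF : y ᵥ* F = z • (y ᵥ* G) := by
    rw [vecMul_sub, vecMul_smul] at hy
    exact (sub_eq_zero.mp hy).symm
  have hG : y ᵥ* G = (1 : ℂ) • (y ᵥ* G) := (one_smul _ _).symm
  have h0 : y ᵥ* G = 0 := by
    by_contra hne
    have h1 := vecMul_lmi_of_proportional hΦ X hF hG
    rw [hX.2.1, vecMul_zero, zero_dotProduct, zero_eq_mul, Complex.ofReal_eq_zero] at h1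
    exact (posDef_vecMul_pos hX.1 hne).ne' (h1.resolve_left hz)
  exact hX.eq_zero_of_vecMul hrow (by rw [hF, h0, smul_zero]) h0

theorem StrictlyFeasible.eigenvaluesIn (hΦ : Φ.IsHermitian) (hΨ : Ψ.IsHermitian)
    {A B X : Matrix (Fin m) (Fin m) ℂ} (hreg : pencilDet A B ≠ 0)
    (hX : StrictlyFeasible Φ Ψ A B X) : EigenvaluesIn A B (curveInterior Φ Ψ) := by
  obtain ⟨c, hc⟩ := exists_det_ne_zero hreg
  have hzero : ∀ y : Fin m → ℂ, y ᵥ* A = 0 → y ᵥ* B = 0 → y = 0 := by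
    intro y hA hB
    by_contra hy
    exact hc (exists_vecMul_eq_zero_iff.mp ⟨y, hy, by simp [vecMul_sub, vecMul_smul, hA, hB]⟩)
  constructor
  · intro z hz
    obtain ⟨y, hy, hy0⟩ := exists_vecMul_eq_zero_iff.mpr hz
    have hA : y ᵥ* A = z • (y ᵥ* B) := by
      rw [vecMul_sub, vecMul_smul] at hy0
      exact (sub_eq_zero.mp hy0).symm
    refine hX.mem_curveInterior hΦ hΨ hA (one_smul _ _).symm hy (fun h => hy ?_) (by simp)
    exact hzero y (by rw [hA, h, smul_zero]) h
  · intro hz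
    obtain ⟨y, hy, hy0⟩ := exists_vecMul_eq_zero_iff.mpr hz
    refine hX.mem_curveInterior hΦ hΨ (u := y ᵥ* A) (one_smul _ _).symm (by rw [hy0, zero_smul]) hy
      (fun h => hy ?_) (by simp)
    exact hzero y h hy0

theorem StrictlyFeasible.nondefective (hΦ : Φ.IsHermitian) (hdet : Φ.det.re < 0)
    {A B X : Matrix (Fin m) (Fin m) ℂ} (hreg : pencilDet A B ≠ 0)
    (hX : StrictlyFeasible Φ Ψ A B X) : Nondefective A B := by
  obtain ⟨c, hc⟩ := exists_det_ne_zero hreg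
  rw [nondefective_iff hc]
  set N := c • B - A with hN
  have hNu : IsUnit N.det := isUnit_iff_ne_zero.mpr hc
  -- Transposing turns a chain into row vectors `v`, `w`, the side on which `lmi` is tested.
  suffices h : IsNondefective (B * N⁻¹)ᵀ by
    intro t
    have ht := h t
    rw [charpoly_transpose] at ht
    rw [ht, ← rank_transpose]
    simp
  apply isNondefective_of_no_chain
  intro t v w hv hw
  rw [mulVec_transpose] at hv hw
  have hBx : ∀ x : Fin m → ℂ, x ᵥ* B = (x ᵥ* (B * N⁻¹)) ᵥ* N := by
    intro x
    rw [vecMul_vecMul, mul_assoc, nonsing_inv_mul _ hNu, mul_one]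
  have hAx : ∀ x : Fin m → ℂ, x ᵥ* A = c • (x ᵥ* B) - x ᵥ* N := by
    intro x
    rw [hN, vecMul_sub, vecMul_smul]
    abel
  have hvB : v ᵥ* B = t • (v ᵥ* N) := by rw [hBx, hv, smul_vecMul]
  have hwB : w ᵥ* B = t • (w ᵥ* N) + v ᵥ* N := by rw [hBx, hw, add_vecMul, smul_vecMul]
  have hvA : v ᵥ* A = (c * t - 1) • (v ᵥ* N) := by rw [hAx, hvB]; module
  have hwA : w ᵥ* A = (c * t - 1) • (w ᵥ* N) + c • (v ᵥ* N) := by rw [hAx, hwB]; module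
  by_contra hv0
  have hu : v ᵥ* N ≠ 0 := by
    intro h
    exact hc (exists_vecMul_eq_zero_iff.mp ⟨v, hv0, h⟩)
  have hpos := (posDef_vecMul_pos hX.1 hu).ne'
  set u := v ᵥ* N
  set u' := w ᵥ* N
  set s := u ᵥ* X ⬝ᵥ star u
  set s' := u' ᵥ* X ⬝ᵥ star u
  -- Testing on `(v, v)` makes `(ct - 1, t)` isotropic; testing on `(w, v)` makes it orthogonal to
  -- `(c, 1)`. The two pairs have determinant 1, so the Gram identity gives `det Φ = 0`.
  have h1 := vecMul_lmi_of_proportional hΦ X hvA hvB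
  rw [hX.2.1, vecMul_zero, zero_dotProduct, zero_eq_mul, or_iff_left hpos, quadForm_coe hΦ] at h1
  have h2 := vecMul_lmi_dotProduct Φ A B X w v
  rw [hX.2.1, vecMul_zero, zero_dotProduct, hvA, hwA, hvB, hwB] at h2
  have h3 : sesq Φ (c * t - 1, t) (c * t - 1, t) * s' +
      sesq Φ (c, 1) (c * t - 1, t) * s = 0 := by
    rw [h2]
    simp only [sesq, add_vecMul, smul_vecMul, star_smul, add_dotProduct, smul_dotProduct,
      dotProduct_smul, smul_eq_mul, s, s']
    ring
  rw [h1, zero_mul, zero_add, mul_eq_zero, or_iff_left hpos] at h3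
  have h4 := sesq_gram Φ (c, 1) (c * t - 1, t)
  rw [h1, h3, show c * t - (c * t - 1) * 1 = 1 by ring] at h4
  have h5 : Φ.det = 0 := by simpa using h4.symm
  simp [h5] at hdet

end PencilFeasibility

/-! ### Construction of `X` from spanning eigenvectors -/

namespace PencilFeasibility

open Matrix
open scoped ComplexOrder

variable {p n : ℕ} {Φ Ψ : Matrix (Fin 2) (Fin 2) ℂ}

/-- The vectors on which `λ G - F` acts as `(λ ν - μ) w` with `(μ, ν)` in `S`. -/
def pencilEigenvectors (F G : Matrix (Fin p) (Fin n) ℂ) (S : Set (ℂ × ℂ)) : Set (Fin n → ℂ) :=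
  {v | ∃ μ ν : ℂ, (μ, ν) ∈ S ∧ ∃ w : Fin p → ℂ, ∀ z : ℂ, (z • G - F) *ᵥ v = (z * ν - μ) • w}

theorem span_eq_top_of_dotProduct {S : Set (Fin n → ℂ)}
    (h : ∀ y : Fin n → ℂ, (∀ v ∈ S, y ⬝ᵥ v = 0) → y = 0) : Submodule.span ℂ S = ⊤ := by
  by_contra hne
  obtain ⟨f, hf, hle⟩ := Submodule.exists_le_ker_of_lt_top _ (lt_top_iff_ne_top.mpr hne)
  have hfv : ∀ v, f v = (fun i => f (Pi.single i 1)) ⬝ᵥ v := by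
    intro v
    rw [LinearMap.pi_apply_eq_sum_univ f v]
    simp only [dotProduct, smul_eq_mul, mul_comm]
    refine Finset.sum_congr rfl fun i _ => ?_
    congr 2
    ext j
    simp [Pi.single_apply, eq_comm]
  have h0 := h _ fun v hv => (hfv v).symm.trans (hle (Submodule.subset_span hv))
  apply hf
  exact LinearMap.ext fun v => by rw [hfv, h0, zero_dotProduct, LinearMap.zero_apply]

theorem lmi_diagonal {ι : Type*} [Fintype ι] [DecidableEq ι] {M : Matrix (Fin 2) (Fin 2) ℂ}
    (hM : M.IsHermitian) {F G : Matrix (Fin p) (Fin n) ℂ} {V : Matrix (Fin n) ι ℂ}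
    {W : Matrix (Fin p) ι ℂ} {μ ν : ι → ℂ} (hF : F * V = W * diagonal μ)
    (hG : G * V = W * diagonal ν) :
    lmi M F G (V * Vᴴ) = W * diagonal (fun i => (quadForm M (μ i) (ν i) : ℂ)) * Wᴴ := by
  have key : ∀ (H K : Matrix (Fin p) (Fin n) ℂ) (a b : ι → ℂ), H * V = W * diagonal a →
      K * V = W * diagonal b →
      H * (V * Vᴴ) * Kᴴ = W * diagonal (fun i => a i * star (b i)) * Wᴴ := by
    intro H K a b hH hK
    calc H * (V * Vᴴ) * Kᴴ = (H * V) * (K * V)ᴴ := by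
          rw [conjTranspose_mul]; simp only [Matrix.mul_assoc]
      _ = W * (diagonal a * diagonal (star b)) * Wᴴ := by
          rw [hH, hK, conjTranspose_mul, diagonal_conjTranspose]; simp only [Matrix.mul_assoc]
      _ = _ := by rw [diagonal_mul_diagonal]; rfl
  rw [lmi, key _ _ _ _ hF hF, key _ _ _ _ hF hG, key _ _ _ _ hG hF, key _ _ _ _ hG hG]
  simp only [← Matrix.smul_mul, ← Matrix.add_mul]
  congr 1
  ext i j
  simp [quadForm_coe hM, sesq]
  ring

/-- The witness is `VVᴴ`, where the columns of `V` span. The hypothesis `h` is the dual form of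
spanning, with the bilinear rather than the Hermitian pairing. -/
theorem exists_strictlyFeasible (hΦ : Φ.IsHermitian) (hΨ : Ψ.IsHermitian)
    {F G : Matrix (Fin p) (Fin n) ℂ} (hrank : normalRank F G = p)
    (h : ∀ y : Fin n → ℂ,
      (∀ v ∈ pencilEigenvectors F G (curveInterior Φ Ψ), y ⬝ᵥ v = 0) → y = 0) :
    ∃ X, StrictlyFeasible Φ Ψ F G X := by
  classical
  obtain ⟨z₀, hz₀⟩ := (normalRank_eq_iff F G).mp hrank
  obtain ⟨s, hsE, hspan, hli⟩ := exists_linearIndependent ℂ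
    (pencilEigenvectors F G (curveInterior Φ Ψ))
  rw [span_eq_top_of_dotProduct h] at hspan
  -- Linear independence serves only to make the spanning family finite.
  have : Finite s := hli.finite
  have : Fintype s := Fintype.ofFinite s
  choose μ ν hμν w hw using fun i : s => hsE i.2
  set V : Matrix (Fin n) s ℂ := of fun a i => (i : Fin n → ℂ) a with hV
  set W : Matrix (Fin p) s ℂ := of fun a i => w i a with hW
  have hcol : ∀ z : ℂ, (z • G - F) * V = W * diagonal (fun i => z * ν i - μ i) := by
    intro z
    ext a i
    rw [mul_diagonal]
    have := congrFun (hw i z) a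
    simpa [mulVec, dotProduct, mul_apply, hV, hW, mul_comm] using this
  have hF : F * V = W * diagonal μ := by
    have := hcol 0
    simp only [zero_smul, zero_sub, Matrix.neg_mul, zero_mul] at this
    rw [← neg_inj, this, ← Matrix.mul_neg, diagonal_neg]
  have hG : G * V = W * diagonal ν := by
    have := hcol 1
    rw [one_smul, Matrix.sub_mul, hF, sub_eq_iff_eq_add, ← Matrix.mul_add, diagonal_add] at this
    simpa using this
  have hVinj : ∀ y : Fin n → ℂ, y ᵥ* V = 0 → y = 0 := by
    intro y hy
    have h1 : ∀ v ∈ Submodule.span ℂ s, y ⬝ᵥ v = 0 := by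
      intro v hv
      induction hv using Submodule.span_induction with
      | mem x hx => exact congrFun hy ⟨x, hx⟩
      | zero => simp
      | add a b _ _ ha hb => rw [dotProduct_add, ha, hb, add_zero]
      | smul c a _ ha => rw [dotProduct_smul, ha, smul_zero]
    rw [hspan] at h1
    exact dotProduct_eq_zero_iff.mp fun v => h1 v trivial
  -- At `z₀` the pencil has full row rank and so has `V`; hence their product, which factors through
  -- `W`, forces full row rank of `W`.
  have hWinj : ∀ y : Fin p → ℂ, y ᵥ* W = 0 → y = 0 := by
    intro y hy
    refine (rank_eq_iff _).mp hz₀ y (hVinj _ ?_)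
    rw [vecMul_vecMul, hcol, ← vecMul_vecMul, hy, zero_vecMul]
  have inj : ∀ {q : ℕ} (U : Matrix (Fin q) s ℂ), (∀ y : Fin q → ℂ, y ᵥ* U = 0 → y = 0) →
      Function.Injective U.vecMul := by
    intro q U hU a b hab
    have hab' : a ᵥ* U = b ᵥ* U := hab
    exact sub_eq_zero.mp (hU _ (by rw [sub_vecMul, hab', sub_self]))
  refine ⟨V * Vᴴ, PosDef.mul_conjTranspose_self V (inj V hVinj), ?_, fun hr => ?_⟩
  · rw [lmi_diagonal hΦ hF hG]
    have : (fun i : s => (quadForm Φ (μ i) (ν i) : ℂ)) = 0 := by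
      ext i
      simp [(hμν i).1.2.1]
    rw [this]
    simp
  · rw [lmi_diagonal hΨ hF hG, ← Matrix.neg_mul, ← Matrix.mul_neg, diagonal_neg]
    refine (PosDef.diagonal fun i => ?_).mul_mul_conjTranspose_same (inj W hWinj)
    have := (hμν i).2 hr
    simp only at this
    rw [← Complex.ofReal_neg, Complex.zero_lt_real]
    linarith

end PencilFeasibility

/-! ### Homogeneous Kronecker blocks, ranks and compression -/

namespace PencilFeasibility

open Matrix
open scoped ComplexOrder

variable {p n m : ℕ} {Φ Ψ : Matrix (Fin 2) (Fin 2) ℂ} {F G : Matrix (Fin p) (Fin n) ℂ}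

/-- The homogeneous version `μ [I 0] - ν [0 I]` of `blockL`. -/
def homBlockL (k : ℕ) (μ ν : ℂ) : Matrix (Fin k) (Fin (k + 1)) ℂ :=
  of fun i j => if j = i.castSucc then μ else if j = i.succ then -ν else 0

/-- For `μ = 0` the nonzero superdiagonal determines each entry of `y`; otherwise forward
substitution along the diagonal does. -/
theorem eq_zero_of_vecMul_homBlockL {k : ℕ} {μ ν : ℂ} (h : (μ, ν) ≠ 0) {y : Fin k → ℂ}
    (hy : y ᵥ* homBlockL k μ ν = 0) : y = 0 := by
  by_cases hμ : μ = 0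
  · have hν : ν ≠ 0 := fun hν => h (by simp [hμ, hν])
    ext a
    have h1 := congrFun hy a.succ
    rw [vecMul, dotProduct, Finset.sum_eq_single a] at h1
    · simpa [homBlockL, hν, hμ, (Fin.castSucc_lt_succ (i := a)).ne'] using h1
    · intro b _ hb
      simp [homBlockL, hμ, Ne.symm hb]
    · simp
  · suffices ∀ (N : ℕ) (a : Fin k), (a : ℕ) = N → y a = 0 by
      ext a; exact this a a rfl
    intro N
    induction N using Nat.strong_induction_on with
    | _ N ih =>
      intro a ha
      have h1 := congrFun hy a.castSucc
      rw [vecMul, dotProduct, Finset.sum_eq_single a] at h1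
      · simpa [homBlockL, hμ] using h1
      · intro b _ hb
        by_cases hs : a.castSucc = b.succ
        · have hlt : (b : ℕ) < N := by
            have := congrArg Fin.val hs
            simp at this
            omega
          rw [ih b hlt b rfl, zero_mul]
        · simp [homBlockL, hs, Ne.symm hb]
      · simp

theorem homBlockL_mulVec {k : ℕ} (μ ν : ℂ) (v : Fin (k + 1) → ℂ) (a : Fin k) :
    (homBlockL k μ ν *ᵥ v) a = μ * v a.castSucc - ν * v a.succ := by
  rw [mulVec, dotProduct, Fintype.sum_eq_add a.castSucc a.succ (Fin.castSucc_lt_succ).ne]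
  · simp [homBlockL, (Fin.castSucc_lt_succ (i := a)).ne']
    ring
  · rintro x ⟨h1, h2⟩
    simp [homBlockL, h1, h2]

theorem blockDiagonal'_mulVec {J : Type*} [Fintype J] [DecidableEq J] {α β : J → Type*}
    [∀ j, Fintype (β j)] (M : ∀ j, Matrix (α j) (β j) ℂ) (v : (Σ j, β j) → ℂ)
    (x : Σ j, α j) :
    (blockDiagonal' M *ᵥ v) x = (M x.1 *ᵥ fun b => v ⟨x.1, b⟩) x.2 := by
  obtain ⟨j, a⟩ := x
  simp only [mulVec, dotProduct, Fintype.sum_sigma]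
  rw [Finset.sum_eq_single j]
  · simp [blockDiagonal'_apply_eq]
  · intro b _ hb
    exact Finset.sum_eq_zero fun c _ => by
      rw [blockDiagonal'_apply_ne _ _ _ (Ne.symm hb), zero_mul]
  · simp

theorem vecMul_blockDiagonal' {J : Type*} [Fintype J] [DecidableEq J] {α β : J → Type*}
    [∀ j, Fintype (α j)] (M : ∀ j, Matrix (α j) (β j) ℂ) (v : (Σ j, α j) → ℂ)
    (x : Σ j, β j) :
    (v ᵥ* blockDiagonal' M) x = ((fun a => v ⟨x.1, a⟩) ᵥ* M x.1) x.2 := by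
  obtain ⟨j, a⟩ := x
  simp only [vecMul, dotProduct, Fintype.sum_sigma]
  rw [Finset.sum_eq_single j]
  · simp [blockDiagonal'_apply_eq]
  · intro b _ hb
    exact Finset.sum_eq_zero fun c _ => by
      rw [blockDiagonal'_apply_ne _ _ _ hb, mul_zero]
  · simp

theorem fromBlocks_sub {α β γ δ : Type*} (A A' : Matrix α γ ℂ) (B B' : Matrix α δ ℂ)
    (C C' : Matrix β γ ℂ) (D D' : Matrix β δ ℂ) :
    fromBlocks A B C D - fromBlocks A' B' C' D' =
      fromBlocks (A - A') (B - B') (C - C') (D - D') := by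
  ext i j
  rcases i with i | i <;> rcases j with j | j <;> rfl

namespace KroneckerForm

/-- The index type of the rows of a Kronecker form. -/
abbrev RowIdx (K : KroneckerForm F G) : Type :=
  (Σ i : Fin K.l, Fin (K.η i + 1)) ⊕ (Fin K.m ⊕ (Σ j : Fin K.r, Fin (K.ε j)))

/-- The index type of the columns of a Kronecker form. -/
abbrev ColIdx (K : KroneckerForm F G) : Type :=
  (Σ i : Fin K.l, Fin (K.η i)) ⊕ (Fin K.m ⊕ (Σ j : Fin K.r, Fin (K.ε j + 1)))

/-- The block diagonal matrix of a Kronecker form at the point `(μ, ν)`. -/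
def blocks (K : KroneckerForm F G) (μ ν : ℂ) : Matrix K.RowIdx K.ColIdx ℂ :=
  fromBlocks (blockDiagonal' fun i => (homBlockL (K.η i) μ ν)ᵀ) 0 0
    (fromBlocks (μ • K.B - ν • K.A) 0 0 (blockDiagonal' fun j => homBlockL (K.ε j) μ ν))

theorem homBlockL_one (k : ℕ) (z : ℂ) : homBlockL k z 1 = blockL k z := rfl

theorem homBlockL_eq (k : ℕ) (μ ν : ℂ) :
    homBlockL k μ ν = μ • (blockL k 1 - blockL k 0) + ν • blockL k 0 := by
  ext i j
  simp only [homBlockL, blockL, of_apply, Matrix.add_apply, Matrix.smul_apply, Matrix.sub_apply,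
    smul_eq_mul]
  split_ifs <;> ring

/-- Linearity in `(μ, ν)` lets the identity given at the points `(z, 1)` extend to infinity. -/
theorem blocks_eq (K : KroneckerForm F G) (μ ν : ℂ) :
    K.blocks μ ν = μ • (K.blocks 1 1 - K.blocks 0 1) + ν • K.blocks 0 1 := by
  simp only [blocks, fromBlocks_smul, fromBlocks_add, fromBlocks_sub, ← blockDiagonal'_smul,
    ← blockDiagonal'_sub, ← blockDiagonal'_add, smul_zero, sub_zero, add_zero, homBlockL_one]
  congr 2
  · ext1 i
    simp [homBlockL_eq (K.η i) μ ν]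
  · simp
    abel
  · congr 1
    ext1 i
    simp [homBlockL_eq (K.ε i) μ ν]

theorem mul_pencil_mul (K : KroneckerForm F G) (μ ν : ℂ) :
    K.P * (μ • G - ν • F) * K.Q = reindex K.rowEquiv K.colEquiv (K.blocks μ ν) := by
  have h : ∀ z : ℂ, K.P * (z • G - F) * K.Q = reindex K.rowEquiv K.colEquiv (K.blocks z 1) := by
    intro z
    rw [K.eq_blocks z, blocks, one_smul]
    rfl
  have e : μ • G - ν • F = μ • (((1 : ℂ) • G - F) - ((0 : ℂ) • G - F)) + ν • ((0 : ℂ) • G - F) := by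
    simp
    abel
  rw [e, Matrix.mul_add, Matrix.add_mul, Matrix.mul_smul, Matrix.mul_smul, Matrix.smul_mul,
    Matrix.smul_mul, Matrix.mul_sub, Matrix.sub_mul, h, h, K.blocks_eq μ ν]
  rfl

theorem rank_eq_iff (K : KroneckerForm F G) (μ ν : ℂ) :
    (μ • G - ν • F).rank = p ↔ ∀ y : K.RowIdx → ℂ, y ᵥ* K.blocks μ ν = 0 → y = 0 := by
  have h : (K.blocks μ ν).rank = (μ • G - ν • F).rank := by
    rw [← rank_reindex K.rowEquiv K.colEquiv, ← K.mul_pencil_mul,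
      rank_mul_eq_left_of_isUnit_det _ _ K.isUnit_Q, rank_mul_eq_right_of_isUnit_det _ _ K.isUnit_P]
  rw [← rank_eq_card_iff, h, Fintype.card_congr K.rowEquiv, Fintype.card_fin]

theorem rank_eq_of_det_ne_zero (K : KroneckerForm F G) (hl : K.l = 0) {μ ν : ℂ}
    (hμν : (μ, ν) ≠ 0) (hdet : (μ • K.B - ν • K.A).det ≠ 0) : (μ • G - ν • F).rank = p := by
  rw [K.rank_eq_iff]
  intro y hy
  have hE : IsEmpty (Fin K.l) := by rw [hl]; infer_instance
  rw [blocks, vecMul_fromBlocks, vecMul_fromBlocks] at hy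
  ext x
  rcases x with ⟨i, _⟩ | x | ⟨j, a⟩
  · exact (hE.false i).elim
  · have h1 : (y ∘ Sum.inr ∘ Sum.inl) ᵥ* (μ • K.B - ν • K.A) = 0 := by
      ext k
      simpa [Function.comp_assoc] using congrFun hy (Sum.inr (Sum.inl k))
    have h2 : y ∘ Sum.inr ∘ Sum.inl = 0 := by
      by_contra hne
      exact hdet (exists_vecMul_eq_zero_iff.mp ⟨_, hne, h1⟩)
    exact congrFun h2 x
  · have h1 : (fun a => y (Sum.inr (Sum.inr ⟨j, a⟩))) ᵥ* homBlockL (K.ε j) μ ν = 0 := by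
      ext k
      have := congrFun hy (Sum.inr (Sum.inr ⟨j, k⟩))
      simpa [vecMul_blockDiagonal'] using this
    exact congrFun (eq_zero_of_vecMul_homBlockL hμν h1) a

theorem l_eq_zero (K : KroneckerForm F G) {z : ℂ} (h : (z • G - F).rank = p) : K.l = 0 := by
  have h' := (K.rank_eq_iff z 1).mp (by rwa [one_smul])
  by_contra hl
  -- The powers `1, z, z², …` form a left null vector of every block `L_η(z)ᵀ`, including `η = 0`.
  have h1 := h' (Sum.elim (fun x => z ^ (x.2 : ℕ)) 0) (by
    rw [blocks, vecMul_fromBlocks]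
    ext x
    rcases x with ⟨i, k⟩ | x
    · have := vecMul_blockDiagonal' (fun i => (homBlockL (K.η i) z 1)ᵀ)
        (fun x : (Σ i : Fin K.l, Fin (K.η i + 1)) => z ^ (x.2 : ℕ)) ⟨i, k⟩
      simp only [vecMul_transpose, homBlockL_mulVec] at this
      simp [Function.comp_def, this, pow_succ, mul_comm]
    · simp)
  have h2 := congrFun h1 (Sum.inl ⟨⟨0, Nat.pos_of_ne_zero hl⟩, 0⟩)
  simp at h2

theorem det_ne_zero (K : KroneckerForm F G) {μ ν : ℂ} (h : (μ • G - ν • F).rank = p) :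
    (μ • K.B - ν • K.A).det ≠ 0 := by
  intro hdet
  obtain ⟨y, hy, hy0⟩ := exists_vecMul_eq_zero_iff.mpr hdet
  have h1 := (K.rank_eq_iff μ ν).mp h (Sum.elim 0 (Sum.elim y 0)) (by
    rw [blocks, vecMul_fromBlocks, vecMul_fromBlocks]
    simp [hy0])
  apply hy
  ext i
  exact congrFun h1 (Sum.inr (Sum.inl i))

theorem normalRank_eq_iff (K : KroneckerForm F G) : normalRank F G = p ↔ K.l = 0 := by
  rw [PencilFeasibility.normalRank_eq_iff]
  constructor
  · rintro ⟨z, hz⟩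
    exact K.l_eq_zero hz
  · intro hl
    obtain ⟨z, hz⟩ := exists_det_ne_zero K.regular
    refine ⟨z, ?_⟩
    have := K.rank_eq_of_det_ne_zero hl (μ := z) (ν := 1) (by simp) (by rwa [one_smul])
    rwa [one_smul] at this

/-- A nonempty regular block has an eigenvalue: either `B` is singular, or `B⁻¹A` has an eigenvalue
over `ℂ`, and the rank drops there. -/
theorem forall_rank_eq_iff (K : KroneckerForm F G) :
    (∀ μ ν : ℂ, (μ, ν) ≠ 0 → (μ • G - ν • F).rank = p) ↔ K.l = 0 ∧ K.m = 0 := by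
  constructor
  · intro h
    refine ⟨K.l_eq_zero (z := 1) (by simpa using h 1 1 (by simp)), ?_⟩
    by_contra hm
    have hB : K.B.det ≠ 0 := by
      have := K.det_ne_zero (h 1 0 (by simp))
      simpa using this
    have hd : 0 < (K.B⁻¹ * K.A).charpoly.degree := by
      rw [charpoly_degree_eq_dim]
      simpa using Nat.pos_of_ne_zero hm
    obtain ⟨z, hz⟩ := IsAlgClosed.exists_root _ hd.ne'
    rw [charpoly_isRoot_iff] at hz
    apply K.det_ne_zero (h z 1 (by simp))
    have : z • K.B - (1 : ℂ) • K.A = -(K.B * (K.B⁻¹ * K.A - z • 1)) := by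
      rw [mul_sub, mul_nonsing_inv_cancel_left _ _ (isUnit_iff_ne_zero.mpr hB)]
      simp
    rw [this, det_neg, det_mul, hz]
    simp
  · rintro ⟨hl, hm⟩ μ ν hμν
    have : IsEmpty (Fin K.m) := by rw [hm]; infer_instance
    exact K.rank_eq_of_det_ne_zero hl hμν (by simp)

theorem pencil_mulVec (K : KroneckerForm F G) (z : ℂ) (c : K.ColIdx → ℂ) :
    (z • G - F) *ᵥ (K.Q *ᵥ (c ∘ K.colEquiv.symm)) =
      K.P⁻¹ *ᵥ ((K.blocks z 1 *ᵥ c) ∘ K.rowEquiv.symm) := by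
  have h1 : K.P⁻¹ * (K.P * (z • G - F) * K.Q) = (z • G - F) * K.Q := by
    rw [Matrix.mul_assoc, ← Matrix.mul_assoc K.P⁻¹, nonsing_inv_mul _ K.isUnit_P, Matrix.one_mul]
  have h2 := K.mul_pencil_mul z 1
  rw [one_smul] at h2
  rw [mulVec_mulVec, ← h1, h2, ← mulVec_mulVec, reindex_apply, submatrix_mulVec_equiv]
  simp [Function.comp_assoc]

/-- `R` and `C` are the rows of `P` and of `Q⁻¹` that belong to the regular block. Their right
inverses keep `C X Cᴴ` and the compressed inequality definite, whatever the other blocks are. -/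
theorem exists_compression (K : KroneckerForm F G) :
    ∃ (R : Matrix (Fin K.m) (Fin p) ℂ) (C : Matrix (Fin K.m) (Fin n) ℂ),
      R * F = K.A * C ∧ R * G = K.B * C ∧
      (∃ R' : Matrix (Fin p) (Fin K.m) ℂ, R * R' = 1) ∧
      (∃ C' : Matrix (Fin n) (Fin K.m) ℂ, C * C' = 1) := by
  have inv : ∀ {q : ℕ} (M : Matrix (Fin q) (Fin q) ℂ) (hM : IsUnit M.det) (e : Fin K.m → Fin q),
      Function.Injective e → M.submatrix e id * M⁻¹.submatrix id e = 1 := by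
    intro q M hM e he
    rw [← submatrix_mul _ _ _ _ _ Function.bijective_id, mul_nonsing_inv _ hM, submatrix_one _ he]
  have key : ∀ μ ν : ℂ, K.P.submatrix (K.rowEquiv ∘ Sum.inr ∘ Sum.inl) id * (μ • G - ν • F) =
      (μ • K.B - ν • K.A) * K.Q⁻¹.submatrix (K.colEquiv ∘ Sum.inr ∘ Sum.inl) id := by
    intro μ ν
    have h1 : K.P * (μ • G - ν • F) = reindex K.rowEquiv K.colEquiv (K.blocks μ ν) * K.Q⁻¹ := by
      rw [← K.mul_pencil_mul, Matrix.mul_assoc, mul_nonsing_inv _ K.isUnit_Q, Matrix.mul_one]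
    ext i k
    have h2 := congrFun (congrFun h1 (K.rowEquiv (Sum.inr (Sum.inl i)))) k
    rw [mul_apply, mul_apply, ← Equiv.sum_comp K.colEquiv] at h2
    rw [mul_apply, mul_apply]
    simp only [submatrix_apply, Function.comp_apply, id] at h2 ⊢
    rw [h2]
    simp [blocks]
  refine ⟨K.P.submatrix (K.rowEquiv ∘ Sum.inr ∘ Sum.inl) id,
    K.Q⁻¹.submatrix (K.colEquiv ∘ Sum.inr ∘ Sum.inl) id, ?_, ?_,
    ⟨_, inv K.P K.isUnit_P _ ?_⟩, ⟨_, inv K.Q⁻¹ ?_ _ ?_⟩⟩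
  · simpa using key 0 (-1)
  · simpa using key 1 0
  · exact K.rowEquiv.injective.comp (Sum.inr_injective.comp Sum.inl_injective)
  · exact isUnit_nonsing_inv_det_iff.mpr K.isUnit_Q
  · exact K.colEquiv.injective.comp (Sum.inr_injective.comp Sum.inl_injective)

theorem strictlyFeasible_regular (K : KroneckerForm F G) {X : Matrix (Fin n) (Fin n) ℂ}
    (hX : StrictlyFeasible Φ Ψ F G X) : ∃ Y, StrictlyFeasible Φ Ψ K.A K.B Y := by
  obtain ⟨R, C, hF, hG, ⟨R', hR⟩, ⟨C', hC⟩⟩ := K.exists_compression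
  have hlmi : ∀ M, lmi M K.A K.B (C * X * Cᴴ) = R * lmi M F G X * Rᴴ := by
    intro M
    have key : ∀ {H L : Matrix (Fin p) (Fin n) ℂ} {H' L' : Matrix (Fin K.m) (Fin K.m) ℂ},
        R * H = H' * C → R * L = L' * C →
        H' * (C * X * Cᴴ) * L'ᴴ = R * (H * X * Lᴴ) * Rᴴ := by
      intro H L H' L' h1 h2
      calc H' * (C * X * Cᴴ) * L'ᴴ = (H' * C) * X * (L' * C)ᴴ := by
            rw [conjTranspose_mul]; simp only [Matrix.mul_assoc]
        _ = _ := by rw [← h1, ← h2, conjTranspose_mul]; simp only [Matrix.mul_assoc]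
    simp only [lmi, Matrix.mul_add, Matrix.add_mul, Matrix.mul_smul, Matrix.smul_mul]
    rw [key hF hF, key hF hG, key hG hF, key hG hG]
  have inj : ∀ {q : ℕ} {U : Matrix (Fin K.m) (Fin q) ℂ} {U' : Matrix (Fin q) (Fin K.m) ℂ},
      U * U' = 1 → Function.Injective U.vecMul := by
    intro q U U' h a b hab
    have hab' : a ᵥ* U = b ᵥ* U := hab
    have := congrArg (· ᵥ* U') hab'
    simpa [vecMul_vecMul, h] using this
  refine ⟨C * X * Cᴴ, hX.1.mul_mul_conjTranspose_same (inj hC), ?_, fun hr => ?_⟩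
  · rw [hlmi, hX.2.1]
    simp
  · rw [hlmi, ← Matrix.neg_mul, ← Matrix.mul_neg]
    exact (hX.2.2 hr).mul_mul_conjTranspose_same (inj hR)

end KroneckerForm

end PencilFeasibility

/-! ### Sufficiency: spanning eigenvectors block by block -/

namespace PencilFeasibility

open Matrix
open scoped ComplexOrder

variable {p n m : ℕ} {Φ Ψ : Matrix (Fin 2) (Fin 2) ℂ} {F G : Matrix (Fin p) (Fin n) ℂ}

theorem eq_zero_of_dotProduct_eigenvectors {A B : Matrix (Fin m) (Fin m) ℂ}
    (hΦ : Φ.IsHermitian) (hΨ : Ψ.IsHermitian) (hreg : pencilDet A B ≠ 0) (hnd : Nondefective A B)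
    (hin : EigenvaluesIn A B (curveInterior Φ Ψ)) {d : Fin m → ℂ}
    (hd : ∀ v ∈ pencilEigenvectors A B (curveInterior Φ Ψ), d ⬝ᵥ v = 0) : d = 0 := by
  obtain ⟨c, hc⟩ := exists_det_ne_zero hreg
  rw [nondefective_iff hc] at hnd
  set N := c • B - A with hN
  have hNu : IsUnit N.det := isUnit_iff_ne_zero.mpr hc
  have hspan := span_eigenvectors hnd
  have hzero : d ᵥ* N⁻¹ = 0 := by
    have h1 : ∀ v ∈ Submodule.span ℂ {v : Fin m → ℂ |
        ∃ t : ℂ, (B * N⁻¹).charpoly.IsRoot t ∧ (B * N⁻¹) *ᵥ v = t • v}, d ᵥ* N⁻¹ ⬝ᵥ v = 0 := by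
      intro v hv
      induction hv using Submodule.span_induction with
      | mem v hv =>
        obtain ⟨t, ht, hvt⟩ := hv
        rcases eq_or_ne v 0 with rfl | hv0
        · simp
        have hz : ∀ z : ℂ, (z • B - A) *ᵥ (N⁻¹ *ᵥ v) = (z * t - (c * t - 1)) • v := by
          intro z
          rw [mulVec_mulVec, pencil_factor hc z, ← hN, mul_assoc, mul_nonsing_inv _ hNu, mul_one,
            add_mulVec, one_mulVec, smul_mulVec, hvt]
          module
        have hu0 : N⁻¹ *ᵥ v ≠ 0 := by
          intro h
          apply hv0
          have := congrArg (N *ᵥ ·) h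
          simpa [mulVec_mulVec, mul_nonsing_inv _ hNu] using this
        rw [← dotProduct_mulVec]
        -- An eigenvector `v` of `T` for `t` gives the pencil eigenvector `N⁻¹ v` with pair `(ct -
        -- 1, t)`, a multiple of `(1, 0)` or of `(c - t⁻¹, 1)`.
        refine hd _ ⟨c * t - 1, t, ?_, v, hz⟩
        rcases eq_or_ne t 0 with rfl | ht0
        · have hB : B.det = 0 := by
            rw [charpoly_isRoot_iff] at ht
            simpa [det_nonsing_inv, hc] using ht
          have := mem_curveInterior_mul hΦ hΨ (neg_ne_zero.mpr one_ne_zero) (hin.2 hB)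
          simpa using this
        · have hA : ((c - t⁻¹) • B - A).det = 0 := by
            refine exists_mulVec_eq_zero_iff.mp ⟨_, hu0, ?_⟩
            rw [hz, show (c - t⁻¹) * t - (c * t - 1) = 0 by field_simp; ring, zero_smul]
          have := mem_curveInterior_mul hΦ hΨ ht0 (hin.1 _ hA)
          rwa [mul_one, show t * (c - t⁻¹) = c * t - 1 by field_simp] at this
      | zero => simp
      | add a b _ _ ha hb => rw [dotProduct_add, ha, hb, add_zero]
      | smul c a _ ha => rw [dotProduct_smul, ha, smul_zero]
    rw [hspan] at h1
    exact dotProduct_eq_zero_iff.mp fun v => h1 v trivial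
  have := congrArg (· ᵥ* N) hzero
  simpa [vecMul_vecMul, nonsing_inv_mul _ hNu] using this

/-- The `k + 1` points of the arc at `t = 1, …, k + 1` are pairwise nonproportional, so their
projective Vandermonde matrix is invertible. -/
theorem eq_zero_of_dotProduct_powers {k : ℕ} {S : Set (ℂ × ℂ)} {x y : ℂ × ℂ}
    (hxy : x.1 * y.2 - y.1 * x.2 ≠ 0)
    (hS : ∀ t : ℝ, 0 < t → (x.1 + t * y.1, x.2 + t * y.2) ∈ S) {d : Fin (k + 1) → ℂ}
    (hd : ∀ μ ν : ℂ, (μ, ν) ∈ S →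
      d ⬝ᵥ (fun a : Fin (k + 1) => ν ^ (k - (a : ℕ)) * μ ^ (a : ℕ)) = 0) : d = 0 := by
  set μ : Fin (k + 1) → ℂ := fun i => x.1 + ((i : ℝ) + 1 : ℝ) * y.1 with hμ
  set ν : Fin (k + 1) → ℂ := fun i => x.2 + ((i : ℝ) + 1 : ℝ) * y.2 with hν
  have hdet : (projVandermonde μ ν).det ≠ 0 := by
    rw [det_projVandermonde]
    refine Finset.prod_ne_zero_iff.mpr fun i _ => Finset.prod_ne_zero_iff.mpr fun j hj => ?_
    have hij : (i : ℂ) ≠ (j : ℂ) := by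
      have := (Finset.mem_Ioi.mp hj).ne
      simpa [Fin.ext_iff] using this
    have : μ j * ν i - μ i * ν j = ((i : ℂ) - j) * (x.1 * y.2 - y.1 * x.2) := by
      simp only [hμ, hν]
      push_cast
      ring
    rw [this]
    exact mul_ne_zero (sub_ne_zero.mpr hij) hxy
  apply eq_zero_of_mulVec_eq_zero hdet
  ext i
  have := hd (μ i) (ν i) (hS _ (by positivity))
  rw [Pi.zero_apply, ← this, mulVec, dotProduct_comm]
  congr 1
  ext a
  rw [projVandermonde_apply, Fin.val_rev, mul_comm]
  congr 2
  omega

namespace KroneckerForm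

theorem exists_strictlyFeasible (K : KroneckerForm F G) (hΦ : Φ.IsHermitian) (hΨ : Ψ.IsHermitian)
    (hdet : Φ.det.re < 0) (hC : HasTwoPoints (curve Φ Ψ)) (hl : K.l = 0)
    (hnd : Nondefective K.A K.B) (hin : EigenvaluesIn K.A K.B (curveInterior Φ Ψ)) :
    ∃ X, StrictlyFeasible Φ Ψ F G X := by
  apply PencilFeasibility.exists_strictlyFeasible hΦ hΨ (K.normalRank_eq_iff.mpr hl)
  intro y hy
  obtain ⟨P₁, P₂, hP, harc⟩ := exists_arc hΦ hΨ hdet hC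
  set d : K.ColIdx → ℂ := (y ᵥ* K.Q) ∘ K.colEquiv with hd
  have hdot : ∀ c : K.ColIdx → ℂ, y ⬝ᵥ (K.Q *ᵥ (c ∘ K.colEquiv.symm)) = d ⬝ᵥ c := by
    intro c
    rw [dotProduct_mulVec, hd, dotProduct, ← Equiv.sum_comp K.colEquiv]
    simp [dotProduct]
  have hmem : ∀ (c : K.ColIdx → ℂ) (μ ν : ℂ) (w : K.RowIdx → ℂ),
      (μ, ν) ∈ curveInterior Φ Ψ → (∀ z, K.blocks z 1 *ᵥ c = (z * ν - μ) • w) → d ⬝ᵥ c = 0 := by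
    intro c μ ν w hμν h
    rw [← hdot]
    refine hy _ ⟨μ, ν, hμν, K.P⁻¹ *ᵥ (w ∘ K.rowEquiv.symm), fun z => ?_⟩
    rw [K.pencil_mulVec, h, ← mulVec_smul]
    rfl
  have h1 : d ∘ Sum.inr ∘ Sum.inl = 0 := by
    refine eq_zero_of_dotProduct_eigenvectors hΦ hΨ K.regular hnd hin ?_
    rintro v ⟨μ, ν, hμν, w, hw⟩
    have := hmem (Sum.elim 0 (Sum.elim v 0)) μ ν (Sum.elim 0 (Sum.elim w 0)) hμν (by
      intro z
      rw [blocks, fromBlocks_mulVec, fromBlocks_mulVec]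
      ext x
      rcases x with x | x | x
      · simp
      · simpa using congrFun (hw z) x
      · simp)
    simpa [dotProduct, Fintype.sum_sum_type] using this
  have h2 : ∀ j : Fin K.r, (fun a => d (Sum.inr (Sum.inr ⟨j, a⟩))) = 0 := by
    intro j
    refine eq_zero_of_dotProduct_powers hP harc ?_
    intro μ ν hμν
    -- On `L_k` the monomial vector is mapped to `(zν - μ)` times the monomial vector of degree `k -
    -- 1`. Rows satisfy `a < k`, so the truncated subtractions are exact.
    have := hmem
      (Sum.elim 0 (Sum.elim 0 fun x => if x.1 = j then ν ^ (K.ε x.1 - x.2) * μ ^ (x.2 : ℕ) else 0))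
      μ ν
      (Sum.elim 0 (Sum.elim 0 fun x =>
        if x.1 = j then ν ^ (K.ε x.1 - x.2 - 1) * μ ^ (x.2 : ℕ) else 0)) hμν (by
      intro z
      rw [blocks, fromBlocks_mulVec, fromBlocks_mulVec]
      ext x
      rcases x with x | x | ⟨j', a⟩
      · simp
      · simp
      · have e : K.ε j' - (a : ℕ) = (K.ε j' - (a : ℕ) - 1) + 1 := by omega
        have e' : K.ε j' - ((a : ℕ) + 1) = K.ε j' - (a : ℕ) - 1 := by omega
        simp only [Function.comp_def, Sum.elim_inr, zero_mulVec, zero_add,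
          Pi.smul_apply, blockDiagonal'_mulVec, homBlockL_mulVec, Fin.val_castSucc, Fin.val_succ,
          smul_eq_mul, e']
        split_ifs
        · rw [e]
          simp only [Nat.add_sub_cancel]
          ring
        · simp)
    rw [dotProduct, Fintype.sum_sum_type, Fintype.sum_sum_type] at this
    simp only [Sum.elim_inl, Sum.elim_inr, Pi.zero_apply, mul_zero, Finset.sum_const_zero,
      zero_add] at this
    rw [Fintype.sum_sigma, Finset.sum_eq_single j] at this
    · simpa [dotProduct] using this
    · intro b _ hb
      simp [hb]
    · simp
  have hE : IsEmpty (Fin K.l) := by rw [hl]; infer_instance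
  have h3 : d = 0 := by
    ext x
    rcases x with ⟨i, _⟩ | x | ⟨j, a⟩
    · exact (hE.false i).elim
    · exact congrFun h1 x
    · exact congrFun (h2 j) a
  have h4 : y ᵥ* K.Q = 0 := by
    ext i
    have := congrFun h3 (K.colEquiv.symm i)
    simpa [hd] using this
  by_contra hne
  exact K.isUnit_Q.ne_zero (exists_vecMul_eq_zero_iff.mp ⟨y, hne, h4⟩)

end KroneckerForm

end PencilFeasibility

/-! ### Kernel chains of minimal degree and their dual systems -/

namespace PencilFeasibility

open Module

variable {V W : Type} [AddCommGroup V] [Module ℂ V] [AddCommGroup W] [Module ℂ W]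

/-- The coefficients of a vector polynomial in the kernel of `λ g - f`. -/
structure IsKernelChain (f g : V →ₗ[ℂ] W) {e : ℕ} (v : Fin (e + 1) → V) : Prop where
  zero : f (v 0) = 0
  step : ∀ k : Fin e, g (v k.castSucc) = f (v k.succ)
  last : g (v (Fin.last e)) = 0

/-- Vanishing low coefficients can be removed by dividing the kernel polynomial by a power of `λ`.
-/
theorem IsKernelChain.exists_head_ne_zero {f g : V →ₗ[ℂ] W} {e : ℕ} {v : Fin (e + 1) → V}
    (hv : IsKernelChain f g v) (hv0 : v ≠ 0) :
    ∃ (e' : ℕ) (v' : Fin (e' + 1) → V), IsKernelChain f g v' ∧ v' 0 ≠ 0 := by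
  induction e with
  | zero =>
    refine ⟨0, v, hv, fun h => hv0 ?_⟩
    ext i
    rw [Fin.fin_one_eq_zero i, h]
    rfl
  | succ e ih =>
    by_cases h : v 0 = 0
    · refine ih (v := fun i => v i.succ) ⟨?_, fun k => hv.step k.succ, hv.last⟩ fun h' => hv0 ?_
      · have := hv.step 0
        rw [Fin.castSucc_zero, h, map_zero] at this
        exact this.symm
      · ext i
        refine Fin.cases h (fun i => congrFun h' i) i
    · exact ⟨_, v, hv, h⟩

theorem exists_isKernelChain [FiniteDimensional ℂ V] [FiniteDimensional ℂ W] (f g : V →ₗ[ℂ] W)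
    (h : finrank ℂ W < finrank ℂ V) :
    ∃ (e : ℕ) (v : Fin (e + 1) → V), IsKernelChain f g v ∧ v 0 ≠ 0 := by
  -- With `e = dim W`, the unknowns number at least `(e + 1)²`, against `e² + 2e` equations.
  set e := finrank ℂ W
  let T : (Fin (e + 1) → V) →ₗ[ℂ] W × (Fin e → W) × W :=
    (f ∘ₗ LinearMap.proj 0).prod ((LinearMap.pi fun k : Fin e =>
      g ∘ₗ LinearMap.proj k.castSucc - f ∘ₗ LinearMap.proj k.succ).prod
        (g ∘ₗ LinearMap.proj (Fin.last e)))
  have hlt : finrank ℂ (W × (Fin e → W) × W) < finrank ℂ (Fin (e + 1) → V) := by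
    simp only [finrank_prod, finrank_pi_fintype, Finset.sum_const, Finset.card_univ,
      Fintype.card_fin, smul_eq_mul]
    change e + (e * e + e) < _
    nlinarith
  obtain ⟨v, hv, hv0⟩ := (LinearMap.ker T).ne_bot_iff.mp (LinearMap.ker_ne_bot_of_finrank_lt hlt)
  have hv' : T v = 0 := hv
  simp only [T, LinearMap.prod_apply, Function.prod_apply, Prod.mk_eq_zero] at hv'
  refine IsKernelChain.exists_head_ne_zero ⟨hv'.1, fun k => ?_, hv'.2.2⟩ hv0
  have := congrFun hv'.2.1 k
  simpa [sub_eq_zero] using this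

/-- Minimality of the degree is equivalent by duality to solvability for `x`: an obstruction would
itself be a shorter kernel chain with head `v 0`. -/
theorem exists_retraction [FiniteDimensional ℂ V] [FiniteDimensional ℂ W] {f g : V →ₗ[ℂ] W} {e : ℕ}
    {v : Fin (e + 1) → V} (hv : IsKernelChain f g v) (hv0 : v 0 ≠ 0)
    (hmin : ∀ e' < e, ∀ v' : Fin (e' + 1) → V, IsKernelChain f g v' → v' 0 = 0) :
    ∃ (x : Fin e → Dual ℂ W) (y : Fin (e + 1) → Dual ℂ V),
      (∀ i, y i.castSucc = x i ∘ₗ g) ∧ (∀ i, y i.succ = x i ∘ₗ f) ∧ y 0 (v 0) = 1 := by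
  cases e with
  | zero =>
    obtain ⟨φ, hφ⟩ : ∃ φ : Dual ℂ V, φ (v 0) ≠ 0 := by
      by_contra! h
      exact hv0 ((forall_dual_apply_eq_zero_iff ℂ _).mp h)
    exact ⟨isEmptyElim, fun _ => (φ (v 0))⁻¹ • φ, isEmptyElim, isEmptyElim, inv_mul_cancel₀ hφ⟩
  | succ e =>
    let T : (Fin (e + 1) → Dual ℂ W) →ₗ[ℂ] (Fin e → Dual ℂ V) :=
      LinearMap.pi fun i => g.dualMap ∘ₗ LinearMap.proj i.succ - f.dualMap ∘ₗ LinearMap.proj i.castSucc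
    have hT : ∀ x i, T x i = x i.succ ∘ₗ g - x i.castSucc ∘ₗ f := fun x i => rfl
    obtain ⟨x, hx, hx0⟩ : ∃ x, T x = 0 ∧ x 0 (g (v 0)) ≠ 0 := by
      by_contra! hcon
      -- If `x ↦ x 0 (g (v 0))` vanishes on `ker T`, it factors through `T` as `M`. The vectors `z
      -- i` representing `M`, negated and placed after `v 0`, form the shorter chain.
      let L : Dual ℂ (Fin (e + 1) → Dual ℂ W) := Dual.eval ℂ W (g (v 0)) ∘ₗ LinearMap.proj 0
      have hL : L ∈ LinearMap.range T.dualMap := by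
        rw [LinearMap.range_dualMap_eq_dualAnnihilator_ker, Submodule.mem_dualAnnihilator]
        exact fun x hx => hcon x hx
      obtain ⟨M, hM⟩ := hL
      let z : Fin e → V := fun i => (evalEquiv ℂ V).symm (M ∘ₗ LinearMap.single ℂ (fun _ => Dual ℂ V) i)
      have hz : ∀ η : Fin e → Dual ℂ V, M η = ∑ i, η i (z i) := by
        intro η
        have h1 : ∀ i, η i (z i) = M (Pi.single i (η i)) := by
          intro i
          simp only [z]
          rw [apply_evalEquiv_symm_apply]
          rfl
        simp only [h1]
        rw [← map_sum, Finset.univ_sum_single]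
      let v' : Fin (e + 1) → V := Fin.cons (v 0) fun i => - z i
      have key : ∀ x : Fin (e + 1) → Dual ℂ W,
          ∑ i, x i (g (v' i)) = ∑ i : Fin e, x i.castSucc (f (v' i.succ)) := by
        intro x
        have h1 : M (T x) = x 0 (g (v 0)) := congrArg (fun l => l x) hM
        rw [hz] at h1
        rw [Fin.sum_univ_succ]
        simp only [v', Fin.cons_zero, Fin.cons_succ, ← h1, hT, LinearMap.sub_apply,
          LinearMap.comp_apply, map_neg, Finset.sum_sub_distrib, Finset.sum_neg_distrib]
        abel
      refine hv0 (hmin e (Nat.lt_succ_self e) v' ⟨hv.zero, fun k => ?_, ?_⟩)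
      · rw [← sub_eq_zero, ← forall_dual_apply_eq_zero_iff ℂ]
        intro φ
        have := key (Pi.single k.castSucc φ)
        rw [Finset.sum_eq_single k.castSucc, Finset.sum_eq_single k] at this
        · simpa [sub_eq_zero] using this
        · intro b _ hb
          rw [Pi.single_eq_of_ne (by simpa using hb)]; rfl
        · simp
        · intro b _ hb
          rw [Pi.single_eq_of_ne hb]; rfl
        · simp
      · rw [← forall_dual_apply_eq_zero_iff ℂ]
        intro φ
        have := key (Pi.single (Fin.last e) φ)
        rw [Finset.sum_eq_single (Fin.last e), Finset.sum_eq_zero] at this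
        · simpa using this
        · intro b _
          rw [Pi.single_eq_of_ne (Fin.castSucc_lt_last b).ne]; rfl
        · intro b _ hb
          rw [Pi.single_eq_of_ne hb]; rfl
        · simp
    set a := x 0 (g (v 0))
    have hx' : ∀ i : Fin e, x i.succ ∘ₗ g = x i.castSucc ∘ₗ f := fun i => by
      rw [← sub_eq_zero, ← hT, hx]; rfl
    refine ⟨fun i => a⁻¹ • x i, Fin.cons ((a⁻¹ • x 0) ∘ₗ g) fun i => (a⁻¹ • x i) ∘ₗ f,
      fun i => ?_, fun i => by rw [Fin.cons_succ], ?_⟩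
    · refine Fin.cases ?_ (fun i => ?_) i
      · rfl
      · rw [← Fin.succ_castSucc, Fin.cons_succ, LinearMap.smul_comp, LinearMap.smul_comp, hx']
    · rw [Fin.cons_zero]
      exact inv_mul_cancel₀ hx0

/-- Biorthogonality splits `V` into the span of `v` and the common kernel of `y`. -/
theorem exists_basis_of_dual {ι κ : Type} [Fintype ι] [DecidableEq ι] (v : ι → V)
    (y : ι → Dual ℂ V) (hy : ∀ i j, y i (v j) = if i = j then 1 else 0) {U : Submodule ℂ V}
    (hU : ∀ x, x ∈ U ↔ ∀ i, y i x = 0) (b : Basis κ ℂ U) :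
    ∃ b' : Basis (ι ⊕ κ) ℂ V, (∀ i, b' (Sum.inl i) = v i) ∧ ∀ k, b' (Sum.inr k) = b k := by
  have hsum : ∀ (c : ι → ℂ) i, y i (∑ j, c j • v j) = c i := by
    intro c i
    simp [hy]
  let E : ((ι → ℂ) × U) ≃ₗ[ℂ] V :=
    { toFun := fun x => ∑ j, x.1 j • v j + x.2
      map_add' := fun x x' => by
        simp only [Prod.fst_add, Prod.snd_add, Pi.add_apply, add_smul, Finset.sum_add_distrib,
          Submodule.coe_add]
        abel
      map_smul' := fun c x => by
        simp [smul_smul, Finset.smul_sum]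
      invFun := fun x => (fun i => y i x, ⟨x - ∑ j, y j x • v j, (hU _).mpr fun i => by
        rw [map_sub, hsum, sub_self]⟩)
      left_inv := fun x => by
        have h0 : ∀ i, y i (∑ j, x.1 j • v j + x.2) = x.1 i := fun i => by
          rw [map_add, hsum, (hU _).mp x.2.2 i, add_zero]
        ext i
        · exact h0 i
        · simp only [h0]
          abel
      right_inv := fun x => by simp }
  refine ⟨((Pi.basisFun ℂ ι).prod b).map E, fun i => ?_, fun k => ?_⟩
  · simp [E, Pi.single_apply]
  · simp [E]

end PencilFeasibility

/-! ### Existence of Kronecker bases -/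

namespace PencilFeasibility

open Module

variable {V W : Type} [AddCommGroup V] [Module ℂ V] [AddCommGroup W] [Module ℂ W]

/-- The matrix `y a (v b)` is constant along diagonals. The end conditions `g (v e) = 0` and `f (v
0) = 0` kill the diagonals above and below the main one. -/
theorem retraction_apply {f g : V →ₗ[ℂ] W} {e : ℕ} {v : Fin (e + 1) → V}
    (hv : IsKernelChain f g v) {x : Fin e → Dual ℂ W} {y : Fin (e + 1) → Dual ℂ V}
    (hyg : ∀ i, y i.castSucc = x i ∘ₗ g) (hyf : ∀ i, y i.succ = x i ∘ₗ f) (hy : y 0 (v 0) = 1)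
    (a b : Fin (e + 1)) : y a (v b) = if a = b then 1 else 0 := by
  have hshift : ∀ i j : Fin e, y i.succ (v j.succ) = y i.castSucc (v j.castSucc) := by
    intro i j
    rw [hyf, hyg, LinearMap.comp_apply, LinearMap.comp_apply, hv.step]
  have hlt : ∀ b a : Fin (e + 1), a < b → y a (v b) = 0 := by
    intro b
    induction b using Fin.reverseInduction with
    | last =>
      intro a ha
      obtain ⟨a, rfl⟩ := Fin.exists_castSucc_eq.mpr ha.ne
      rw [hyg, LinearMap.comp_apply, hv.last, map_zero]
    | cast b ih =>
      intro a ha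
      obtain ⟨a, rfl⟩ := Fin.exists_castSucc_eq.mpr (ha.trans (Fin.castSucc_lt_last b)).ne
      rw [← hshift]
      exact ih _ (by simpa using ha)
  induction b using Fin.induction generalizing a with
  | zero =>
    refine Fin.cases ?_ (fun a => ?_) a
    · simp [hy]
    · rw [hyf, LinearMap.comp_apply, hv.zero, map_zero, if_neg (Fin.succ_ne_zero a)]
  | succ b ih =>
    refine Fin.cases ?_ (fun a => ?_) a
    · rw [hlt _ _ (Fin.succ_pos b), if_neg (Fin.succ_ne_zero b).symm]
    · rw [hshift, ih]
      simp

/-- Adding a summand to a disjoint union indexed by `Option J`. -/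
def insertEquiv {J : Type} (M : Type) (t : Option J → Type) :
    (t none ⊕ (M ⊕ Σ j, t (some j))) ≃ (M ⊕ Σ j, t j) where
  toFun
    | Sum.inl a => Sum.inr ⟨none, a⟩
    | Sum.inr (Sum.inl i) => Sum.inl i
    | Sum.inr (Sum.inr ⟨j, a⟩) => Sum.inr ⟨some j, a⟩
  invFun
    | Sum.inl i => Sum.inr (Sum.inl i)
    | Sum.inr ⟨none, a⟩ => Sum.inl a
    | Sum.inr ⟨some j, a⟩ => Sum.inr (Sum.inr ⟨j, a⟩)
  left_inv := by rintro (a | i | ⟨j, a⟩) <;> rfl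
  right_inv := by rintro (i | ⟨_ | j, a⟩) <;> rfl

/-- Bases in which the pencil `λ g - f` is block diagonal with blocks `λ B - A` and `L_{ε j}`. -/
structure IsKroneckerBasis (f g : V →ₗ[ℂ] W) {m : ℕ} {J : Type} {ε : J → ℕ}
    (A B : Matrix (Fin m) (Fin m) ℂ) (bV : Basis (Fin m ⊕ Σ j, Fin (ε j + 1)) ℂ V)
    (bW : Basis (Fin m ⊕ Σ j, Fin (ε j)) ℂ W) : Prop where
  f_inl : ∀ i, f (bV (Sum.inl i)) = ∑ k, A k i • bW (Sum.inl k)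
  g_inl : ∀ i, g (bV (Sum.inl i)) = ∑ k, B k i • bW (Sum.inl k)
  f_zero : ∀ j, f (bV (Sum.inr ⟨j, 0⟩)) = 0
  f_succ : ∀ j k, f (bV (Sum.inr ⟨j, Fin.succ k⟩)) = bW (Sum.inr ⟨j, k⟩)
  g_castSucc : ∀ j k, g (bV (Sum.inr ⟨j, Fin.castSucc k⟩)) = bW (Sum.inr ⟨j, k⟩)
  g_last : ∀ j, g (bV (Sum.inr ⟨j, Fin.last _⟩)) = 0

theorem exists_kroneckerBasis_of_bijective [FiniteDimensional ℂ V] [FiniteDimensional ℂ W]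
    {f g : V →ₗ[ℂ] W} {z : ℂ} (hz : Function.Bijective (z • g - f)) :
    ∃ (m : ℕ) (A B : Matrix (Fin m) (Fin m) ℂ)
      (bV : Basis (Fin m ⊕ Σ _ : Empty, Fin (0 + 1)) ℂ V)
      (bW : Basis (Fin m ⊕ Σ _ : Empty, Fin 0) ℂ W),
      (z • B - A).det ≠ 0 ∧ IsKroneckerBasis (ε := fun _ : Empty => 0) f g A B bV bW := by
  have hd := (LinearEquiv.ofBijective _ hz).finrank_eq
  let bV := finBasis ℂ V
  let bW := (finBasis ℂ W).reindex (finCongr hd.symm)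
  refine ⟨_, LinearMap.toMatrix bV bW f, LinearMap.toMatrix bV bW g,
    bV.reindex (Equiv.sumEmpty _ _).symm, bW.reindex (Equiv.sumEmpty _ _).symm, ?_,
    ⟨fun i => ?_, fun i => ?_, fun j => j.elim, fun j => j.elim, fun j => j.elim, fun j => j.elim⟩⟩
  · have h1 := (LinearEquiv.isUnit_det (LinearEquiv.ofBijective _ hz) bV bW).ne_zero
    have h2 : LinearMap.toMatrix bV bW (LinearEquiv.ofBijective _ hz : V →ₗ[ℂ] W) =
        z • LinearMap.toMatrix bV bW g - LinearMap.toMatrix bV bW f := by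
      rw [← map_smul, ← map_sub]
      rfl
    rwa [h2] at h1
  · simp only [Basis.reindex_apply, Equiv.symm_symm, Equiv.sumEmpty_apply_inl,
      LinearMap.toMatrix_apply]
    exact (bW.sum_repr _).symm
  · simp only [Basis.reindex_apply, Equiv.symm_symm, Equiv.sumEmpty_apply_inl,
      LinearMap.toMatrix_apply]
    exact (bW.sum_repr _).symm

/-- Induction on `dim V`: surjectivity at one `z` rules out blocks `Lᵀ`, and it passes to the common
kernels `V₂`, `W₂` after a minimal chain is split off. When the dimensions agree, the pencil is
regular. -/
theorem exists_kroneckerBasis (N : ℕ) : ∀ (V W : Type) [AddCommGroup V] [Module ℂ V]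
    [AddCommGroup W] [Module ℂ W] [FiniteDimensional ℂ V] [FiniteDimensional ℂ W]
    (f g : V →ₗ[ℂ] W) (z : ℂ), finrank ℂ V = N → Function.Surjective (z • g - f) →
    ∃ (m : ℕ) (J : Type) (_ : Fintype J) (ε : J → ℕ) (A B : Matrix (Fin m) (Fin m) ℂ)
      (bV : Basis (Fin m ⊕ Σ j, Fin (ε j + 1)) ℂ V) (bW : Basis (Fin m ⊕ Σ j, Fin (ε j)) ℂ W),
      (z • B - A).det ≠ 0 ∧ IsKroneckerBasis f g A B bV bW := by
  classical
  induction N using Nat.strong_induction_on with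
  | _ N ih =>
  intro V W _ _ _ _ _ _ f g z hN hz
  by_cases hle : finrank ℂ V ≤ finrank ℂ W
  · have heq := le_antisymm hle (LinearMap.finrank_le_finrank_of_surjective hz)
    obtain ⟨m, A, B, bV, bW, h⟩ := exists_kroneckerBasis_of_bijective (f := f) (g := g) (z := z)
      ⟨(LinearMap.injective_iff_surjective_of_finrank_eq_finrank heq).mpr hz, hz⟩
    exact ⟨m, Empty, inferInstance, _, A, B, bV, bW, h⟩
  · have hex := exists_isKernelChain f g (not_le.mp hle)
    obtain ⟨v, hv, hv0⟩ := Nat.find_spec hex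
    have hmin : ∀ e' < Nat.find hex, ∀ v' : Fin (e' + 1) → V,
        IsKernelChain f g v' → v' 0 = 0 := by
      intro e' he v' hv'
      by_contra h
      exact Nat.find_min hex he ⟨v', hv', h⟩
    generalize Nat.find hex = e at v hv hv0 hmin
    obtain ⟨x, y, hyg, hyf, hy0⟩ := exists_retraction hv hv0 hmin
    have hyv := retraction_apply hv hyg hyf hy0
    let w : Fin e → W := fun i => g (v i.castSucc)
    have hxw : ∀ i j, x i (w j) = if i = j then 1 else 0 := by
      intro i j
      have := hyv i.castSucc j.castSucc
      rw [hyg] at this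
      simpa using this
    let V₂ : Submodule ℂ V := ⨅ i, LinearMap.ker (y i)
    let W₂ : Submodule ℂ W := ⨅ i, LinearMap.ker (x i)
    have hV₂ : ∀ u, u ∈ V₂ ↔ ∀ i, y i u = 0 := by simp [V₂]
    have hW₂ : ∀ u, u ∈ W₂ ↔ ∀ i, x i u = 0 := by simp [W₂]
    have hf : ∀ u ∈ V₂, f u ∈ W₂ := fun u hu => (hW₂ _).mpr fun i => by
      have := (hV₂ u).mp hu i.succ
      rwa [hyf] at this
    have hg : ∀ u ∈ V₂, g u ∈ W₂ := fun u hu => (hW₂ _).mpr fun i => by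
      have := (hV₂ u).mp hu i.castSucc
      rwa [hyg] at this
    have hlt : finrank ℂ V₂ < N := by
      rw [← hN]
      refine Submodule.finrank_lt fun h => ?_
      have : v 0 ∈ V₂ := h ▸ Submodule.mem_top
      have := (hV₂ _).mp this 0
      rw [hy0] at this
      exact one_ne_zero this
    have hsurj : Function.Surjective (z • g.restrict hg - f.restrict hf) := by
      rintro ⟨u, hu⟩
      obtain ⟨s, hs⟩ := hz u
      -- A preimage `s` of `u` is corrected by its component along the chain. As every `x i` kills
      -- `u`, that component lies in the kernel of `z • g - f`.
      set c : Fin (e + 1) → ℂ := fun i => y i s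
      have hc : ∀ i : Fin e, z * c i.castSucc - c i.succ = 0 := by
        intro i
        rw [← (hW₂ u).mp hu i, ← hs]
        simp [c, hyg, hyf]
      have hgc : g (∑ j, c j • v j) = ∑ i : Fin e, c i.castSucc • w i := by
        rw [Fin.sum_univ_castSucc, map_add, map_smul, hv.last, smul_zero, add_zero, map_sum]
        simp [w]
      have hfc : f (∑ j, c j • v j) = ∑ i : Fin e, c i.succ • w i := by
        rw [Fin.sum_univ_succ, map_add, map_smul, hv.zero, smul_zero, zero_add, map_sum]
        simp [w, hv.step]
      have hzc : (z • g - f) (∑ j, c j • v j) = 0 := by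
        rw [LinearMap.sub_apply, LinearMap.smul_apply, hgc, hfc, Finset.smul_sum,
          ← Finset.sum_sub_distrib]
        refine Finset.sum_eq_zero fun i _ => ?_
        rw [smul_smul, ← sub_smul, hc, zero_smul]
      refine ⟨⟨s - ∑ j, c j • v j, (hV₂ _).mpr fun i => ?_⟩, Subtype.ext ?_⟩
      · simp [hyv, c]
      · have : (z • g - f) (s - ∑ j, c j • v j) = u := by rw [map_sub, hzc, hs, sub_zero]
        exact this
    obtain ⟨m, J, hJ, ε, A, B, bV, bW, hdet, hK⟩ :=
      ih _ hlt V₂ W₂ (f.restrict hf) (g.restrict hg) z rfl hsurj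
    obtain ⟨bV', hV1, hV2⟩ := exists_basis_of_dual v y hyv hV₂ bV
    obtain ⟨bW', hW1, hW2⟩ := exists_basis_of_dual w x hxw hW₂ bW
    have hV3 : ∀ q, bV'.reindex (insertEquiv (Fin m) fun j : Option J => Fin (j.elim e ε + 1)) q =
        bV' ((insertEquiv (Fin m) fun j : Option J => Fin (j.elim e ε + 1)).symm q) :=
      fun q => Basis.reindex_apply _ _ _
    have hW3 : ∀ q, bW'.reindex (insertEquiv (Fin m) fun j : Option J => Fin (j.elim e ε)) q =
        bW' ((insertEquiv (Fin m) fun j : Option J => Fin (j.elim e ε)).symm q) :=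
      fun q => Basis.reindex_apply _ _ _
    refine ⟨m, Option J, inferInstance, fun j => j.elim e ε, A, B,
      bV'.reindex (insertEquiv (Fin m) fun j => Fin (j.elim e ε + 1)),
      bW'.reindex (insertEquiv (Fin m) fun j => Fin (j.elim e ε)), hdet,
      ⟨fun i => ?_, fun i => ?_, ?_, ?_, ?_, ?_⟩⟩
    · have := congrArg Subtype.val (hK.f_inl i)
      simpa [hV3, hW3, insertEquiv, hV2, hW2] using this
    · have := congrArg Subtype.val (hK.g_inl i)
      simpa [hV3, hW3, insertEquiv, hV2, hW2] using this
    · rintro (_ | j)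
      · rw [hV3]
        exact (congrArg f (hV1 0)).trans hv.zero
      · rw [hV3]
        exact (congrArg f (hV2 _)).trans (congrArg Subtype.val (hK.f_zero j))
    · rintro (_ | j) k
      · rw [hV3, hW3]
        exact (congrArg f (hV1 _)).trans ((hv.step k).symm.trans (hW1 k).symm)
      · rw [hV3, hW3]
        exact (congrArg f (hV2 _)).trans
          ((congrArg Subtype.val (hK.f_succ j k)).trans (hW2 _).symm)
    · rintro (_ | j) k
      · rw [hV3, hW3]
        exact (congrArg g (hV1 _)).trans (hW1 k).symm
      · rw [hV3, hW3]
        exact (congrArg g (hV2 _)).trans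
          ((congrArg Subtype.val (hK.g_castSucc j k)).trans (hW2 _).symm)
    · rintro (_ | j)
      · rw [hV3]
        exact (congrArg g (hV1 _)).trans hv.last
      · rw [hV3]
        exact (congrArg g (hV2 _)).trans (congrArg Subtype.val (hK.g_last j))

end PencilFeasibility

/-! ### From bases to a matrix Kronecker form -/

namespace PencilFeasibility

open Matrix Module

variable {p n : ℕ} {F G : Matrix (Fin p) (Fin n) ℂ}

theorem isUnit_det_basis {q : ℕ} {ι : Type} (b : Basis ι ℂ (Fin q → ℂ)) (e : ι ≃ Fin q) :
    IsUnit (of fun (a k : Fin q) => b (e.symm k) a).det := by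
  have h := (Pi.basisFun ℂ (Fin q)).isUnit_det (b.reindex e)
  rw [Basis.det_apply] at h
  convert h using 2
  ext a k
  simp [Basis.toMatrix_apply]

theorem exists_kroneckerForm_of_basis {m : ℕ} {J : Type} [Fintype J] {ε : J → ℕ}
    {A B : Matrix (Fin m) (Fin m) ℂ} {bV : Basis (Fin m ⊕ Σ j, Fin (ε j + 1)) ℂ (Fin n → ℂ)}
    {bW : Basis (Fin m ⊕ Σ j, Fin (ε j)) ℂ (Fin p → ℂ)} {z₀ : ℂ} (hdet : (z₀ • B - A).det ≠ 0)
    (h : IsKroneckerBasis F.mulVecLin G.mulVecLin A B bV bW) : Nonempty (KroneckerForm F G) := by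
  classical
  let s : Fin (Fintype.card J) ≃ J := (Fintype.equivFin J).symm
  let cE := Equiv.sumCongr (Equiv.refl (Fin m))
    (Equiv.sigmaCongrLeft (β := fun j => Fin (ε j + 1)) s)
  let rE := Equiv.sumCongr (Equiv.refl (Fin m)) (Equiv.sigmaCongrLeft (β := fun j => Fin (ε j)) s)
  let cF := cE.trans (bV.indexEquiv (Pi.basisFun ℂ (Fin n)))
  let rF := rE.trans (bW.indexEquiv (Pi.basisFun ℂ (Fin p)))
  -- The columns of `Q` and `R` are the new basis vectors, so the transformation on the left is `P =
  -- R⁻¹`.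
  let Q : Matrix (Fin n) (Fin n) ℂ := of fun a k => bV (cE (cF.symm k)) a
  let R : Matrix (Fin p) (Fin p) ℂ := of fun a k => bW (rE (rF.symm k)) a
  have hQ : IsUnit Q.det := by
    have := isUnit_det_basis bV (bV.indexEquiv (Pi.basisFun ℂ (Fin n)))
    convert this using 5
    simp [cF]
  have hR : IsUnit R.det := by
    have := isUnit_det_basis bW (bW.indexEquiv (Pi.basisFun ℂ (Fin p)))
    convert this using 5
    simp [rF]
  refine ⟨{
    l := 0
    η := Fin.elim0
    m := m
    A := A
    B := B
    r := Fintype.card J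
    ε := fun j => ε (s j)
    P := R⁻¹
    Q := Q
    rowEquiv := (Equiv.emptySum _ _).trans rF
    colEquiv := (Equiv.emptySum _ _).trans cF
    isUnit_P := isUnit_nonsing_inv_det_iff.mpr hR
    isUnit_Q := hQ
    regular := fun h0 => hdet (by rw [← eval_pencilDet, h0, Polynomial.eval_zero])
    eq_blocks := fun z => ?_ }⟩
  have hf : ∀ (j : J) (k : Fin (ε j + 1)), F *ᵥ bV (Sum.inr ⟨j, k⟩) =
      ∑ a : Fin (ε j), (if k = a.succ then (1 : ℂ) else 0) • bW (Sum.inr ⟨j, a⟩) := by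
    intro j k
    refine Fin.cases ?_ (fun k => ?_) k
    · rw [Finset.sum_eq_zero fun a _ => by rw [if_neg (Fin.succ_ne_zero a).symm, zero_smul]]
      exact h.f_zero j
    · simpa using h.f_succ j k
  have hg : ∀ (j : J) (k : Fin (ε j + 1)), G *ᵥ bV (Sum.inr ⟨j, k⟩) =
      ∑ a : Fin (ε j), (if k = a.castSucc then (1 : ℂ) else 0) • bW (Sum.inr ⟨j, a⟩) := by
    intro j k
    refine Fin.lastCases ?_ (fun k => ?_) k
    · rw [Finset.sum_eq_zero fun a _ => by rw [if_neg (Fin.castSucc_lt_last a).ne', zero_smul]]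
      exact h.g_last j
    · simpa using h.g_castSucc j k
  have key : ∀ c : Fin m ⊕ Σ j : Fin (Fintype.card J), Fin (ε (s j) + 1),
      (z • G - F) *ᵥ bV (cE c) = ∑ x, (fromBlocks (z • B - A) 0 0
        (blockDiagonal' fun j : Fin (Fintype.card J) => blockL (ε (s j)) z)) x c • bW (rE x) := by
    intro c
    rw [sub_mulVec, smul_mulVec, Fintype.sum_sum_type]
    rcases c with i | ⟨j, k⟩
    · have h1 : F *ᵥ bV (Sum.inl i) = _ := h.f_inl i
      have h2 : G *ᵥ bV (Sum.inl i) = _ := h.g_inl i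
      simp [cE, rE, h1, h2, sub_smul, Finset.smul_sum, smul_smul]
    · rw [Fintype.sum_sigma, Finset.sum_eq_single j (fun b _ hb =>
        Finset.sum_eq_zero fun a _ => by
          rw [fromBlocks_apply₂₂, blockDiagonal'_apply_ne _ _ _ hb, zero_smul]) (by simp)]
      have h1 := hf (s j) k
      have h2 := hg (s j) k
      have e1 : cE (Sum.inr ⟨j, k⟩) = Sum.inr ⟨s j, k⟩ := rfl
      have e2 : ∀ a, rE (Sum.inr ⟨j, a⟩) = Sum.inr ⟨s j, a⟩ := fun a => rfl
      rw [e1, h1, h2, Finset.smul_sum, ← Finset.sum_sub_distrib]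
      simp only [fromBlocks_apply₁₂, Matrix.zero_apply, zero_smul, Finset.sum_const_zero,
        zero_add, fromBlocks_apply₂₂, blockDiagonal'_apply_eq, e2]
      refine Finset.sum_congr rfl fun a _ => ?_
      rw [smul_smul, ← sub_smul]
      congr 1
      have hne : a.castSucc ≠ a.succ := (Fin.castSucc_lt_succ).ne
      simp only [blockL, of_apply]
      split_ifs with h3 h4 <;> simp_all
  have hmul : (z • G - F) * Q = R * reindex rF cF (fromBlocks (z • B - A) 0 0
      (blockDiagonal' fun j : Fin (Fintype.card J) => blockL (ε (s j)) z)) := by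
    ext a k
    have h1 := congrFun (key (cF.symm k)) a
    simp only [Finset.sum_apply, Pi.smul_apply, smul_eq_mul] at h1
    rw [show ((z • G - F) * Q) a k = ((z • G - F) *ᵥ bV (cE (cF.symm k))) a from rfl, h1,
      mul_apply, ← Equiv.sum_comp rF]
    simp only [reindex_apply, submatrix_apply, Equiv.symm_apply_apply, R, of_apply]
    exact Finset.sum_congr rfl fun x _ => mul_comm _ _
  rw [Matrix.mul_assoc, hmul, ← Matrix.mul_assoc, nonsing_inv_mul _ hR, Matrix.one_mul]
  ext a k
  simp only [reindex_apply, submatrix_apply]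
  rfl

theorem exists_kroneckerForm (h : normalRank F G = p) : Nonempty (KroneckerForm F G) := by
  obtain ⟨z, hz⟩ := (normalRank_eq_iff F G).mp h
  have hsurj : Function.Surjective (z • G.mulVecLin - F.mulVecLin) := by
    rw [← LinearMap.range_eq_top]
    apply Submodule.eq_top_of_finrank_eq
    rw [finrank_fin_fun]
    have : z • G.mulVecLin - F.mulVecLin = (z • G - F).mulVecLin := by
      ext
      simp
    rw [this]
    exact hz
  obtain ⟨m, J, hJ, ε, A, B, bV, bW, hdet, hK⟩ :=
    exists_kroneckerBasis _ _ _ F.mulVecLin G.mulVecLin z rfl hsurj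
  exact exists_kroneckerForm_of_basis hdet hK

end PencilFeasibility

/-! ### The main theorem -/

theorem mainTheorem6 {p n : ℕ} (F G : Matrix (Fin p) (Fin n) ℂ)
    (Φ Ψ : Matrix (Fin 2) (Fin 2) ℂ) (hΦ : Φ.IsHermitian) (hΨ : Ψ.IsHermitian)
    (hdet : Φ.det.re < 0)
    (hC : PencilFeasibility.HasTwoPoints (PencilFeasibility.curve Φ Ψ))
    (hrow : PencilFeasibility.IsRedundant Φ Ψ → (Matrix.fromCols F G).rank = p) :
    ((∃ X, PencilFeasibility.StrictlyFeasible Φ Ψ F G X) ↔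
      PencilFeasibility.normalRank F G = p ∧
      ∃ K : PencilFeasibility.KroneckerForm F G,
        PencilFeasibility.Nondefective K.A K.B ∧
        PencilFeasibility.EigenvaluesIn K.A K.B (PencilFeasibility.curveInterior Φ Ψ)) ∧
    (∀ K : PencilFeasibility.KroneckerForm F G,
      ((∃ X, PencilFeasibility.StrictlyFeasible Φ Ψ F G X) ↔
        PencilFeasibility.normalRank F G = p ∧
        PencilFeasibility.Nondefective K.A K.B ∧
        PencilFeasibility.EigenvaluesIn K.A K.B (PencilFeasibility.curveInterior Φ Ψ)) ∧
      (PencilFeasibility.normalRank F G = p ↔ K.l = 0) ∧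
      ((∀ μ ν : ℂ, (μ, ν) ≠ 0 → (μ • G - ν • F).rank = p) ↔ K.l = 0 ∧ K.m = 0)) ∧
    ((∀ μ ν : ℂ, (μ, ν) ≠ 0 → (μ • G - ν • F).rank = p) →
      ∃ X, PencilFeasibility.StrictlyFeasible Φ Ψ F G X) := by
  have hiff : ∀ K : PencilFeasibility.KroneckerForm F G,
      ((∃ X, PencilFeasibility.StrictlyFeasible Φ Ψ F G X) ↔
        PencilFeasibility.normalRank F G = p ∧
        PencilFeasibility.Nondefective K.A K.B ∧
        PencilFeasibility.EigenvaluesIn K.A K.B (PencilFeasibility.curveInterior Φ Ψ)) := by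
    intro K
    constructor
    · rintro ⟨X, hX⟩
      obtain ⟨Y, hY⟩ := K.strictlyFeasible_regular hX
      exact ⟨hX.normalRank_eq hΦ hdet hrow, hY.nondefective hΦ hdet K.regular,
        hY.eigenvaluesIn hΦ hΨ K.regular⟩
    · rintro ⟨hr, hnd, hin⟩
      exact K.exists_strictlyFeasible hΦ hΨ hdet hC (K.normalRank_eq_iff.mp hr) hnd hin
  refine ⟨⟨?_, ?_⟩, fun K => ⟨hiff K, K.normalRank_eq_iff, K.forall_rank_eq_iff⟩, ?_⟩
  -- Feasibility already gives normal rank `p`, which is what the existence of a Kronecker form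
  -- requires.
  · rintro ⟨X, hX⟩
    have hr := hX.normalRank_eq hΦ hdet hrow
    obtain ⟨K⟩ := PencilFeasibility.exists_kroneckerForm hr
    exact ⟨hr, K, ((hiff K).mp ⟨X, hX⟩).2⟩
  · rintro ⟨hr, K, hK⟩
    exact (hiff K).mpr ⟨hr, hK⟩
  · intro h
    have hr : PencilFeasibility.normalRank F G = p :=
      (PencilFeasibility.normalRank_eq_iff F G).mpr ⟨1, by simpa using h 1 1 (by simp)⟩
    obtain ⟨K⟩ := PencilFeasibility.exists_kroneckerForm hr
    obtain ⟨hl, hm⟩ := K.forall_rank_eq_iff.mp h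
    have hE : IsEmpty (Fin K.m) := by rw [hm]; infer_instance
    -- With `m = 0` there are no eigenvalues, the empty determinant being 1, and the conditions hold
    -- vacuously.
    refine K.exists_strictlyFeasible hΦ hΨ hdet hC hl ⟨fun z hz => ?_, fun hz => ?_⟩
      ⟨fun z hz => ?_, fun hz => ?_⟩ <;>
    · exact absurd hz (by simp [PencilFeasibility.IsFiniteEigenvalue,
        PencilFeasibility.IsInfiniteEigenvalue])
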